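/- **Setting.** Let $(\Omega,\mathbb P)$ be a probability space carrying the data and the Monte Carlo randomization. Let $\Theta$ be a topological space with its Borel $\sigma$-algebra, $L:\Theta\to[-\infty,\infty]$ a population criterion, $\Theta_I=\{\theta: L(\theta)=\sup_{\vartheta} L(\vartheta)\}\ne\emptyset$ the identified set, $L_n$ jointly measurable sample criteria, and $\Pi$ a prior on $\Theta$. The quasi-posterior is $d\Pi_n(\theta)=e^{nL_n(\theta)}d\Pi(\theta)/\int e^{nL_n}d\Pi$. With $\hat\theta$ as in assumption 2, put $Q_n(\theta)=2n[L_n(\hat\theta)-L_n(\theta)]$. For $\alpha\in(0,1)$ and draws $\theta^1,\dots,\theta^{B_n}\in\Theta$ ($B_n\ge 1$), $\xi^{post}_{n,\alpha}$ denotes the $\alpha$ quantile of $Q_n$ under $\Pi_n$, $\xi^{mc}_{n,\alpha}$ the $\alpha$ quantile of $\{Q_n(\theta^b)\}_b$, and $\zeta^{mc}_{n,\alpha}$ the $(1-\alpha)$ quantile of $\{L_n(\theta^b)\}_b$, where the $\alpha$ quantile of a distribution function $F$ is $\inf\{c\in\mathbb R:F(c)\ge\alpha\}$. The confidence set is $\widehat\Theta_\alpha=\{\theta:L_n(\theta)\ge\zeta^{mc}_{n,\alpha}\}$,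 or in its QLR form $\widehat\Theta'_\alpha=\{\theta:Q_n(\theta)\le\xi^{mc}_{n,\alpha}\}$. **Assumptions.** 1. (Local reduced form.) There are a neighborhood $\Theta_I^N$ of $\Theta_I$, neighborhoods $\Theta_{osn}$ of $\Theta_I$ with $\Theta_{osn}\subseteq\Theta_I^N$ for large $n$, and a map $(\gamma,\gamma_\perp):\Theta_I^N\to\Gamma\times\Gamma_\perp\subseteq\mathbb R^{d^*}\times\mathbb R^{k}$ ($d^*\ge1$, $k\ge 0$), all measurable, with $(\gamma(\theta),\gamma_\perp(\theta))=0$ if and only if $\theta\in\Theta_I$. The sets $T_{osn}=\{\sqrt n\gamma(\theta):\theta\in\Theta_{osn}\}$ cover a closed convex cone $T\subseteq\mathbb R^{d^*}$ of positive Lebesgue measure. That is, $\sup_{\|b\|\le M}|\inf_{a\in T_{osn}}\|a-b\|^2-\inf_{a\in T}\|a-b\|^2|\to0$ for every $M$, and for some closed balls $B_{k_n}$ about $0$ of radius $k_n\to\infty$ the sets $T_{osn}\cap B_{k_n}$ are convex and increasing, and the closure of their union is $T$. The sets $\{\gamma(\theta):\theta\in\Theta_{osn}\}$ and $\{\gamma_\perp(\theta):\theta\in\Theta_{osn}\}$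 are Lebesgue measurable. Moreover $\Theta_{osn}$ is locally determined by the reduced form: for some $r_n\to\infty$ and all large $n$, $\Pi$-almost every $\theta\in\Theta_I^N$ with $\sqrt n\|\gamma(\theta)\|\le r_n$ and $(\gamma(\theta),\gamma_\perp(\theta))\in\{(\gamma(\vartheta),\gamma_\perp(\vartheta)):\vartheta\in\Theta_{osn}\}$ lies in $\Theta_{osn}$. 2. (Posterior contraction.) $L_n(\hat\theta)=\sup_{\theta\in\Theta_{osn}}L_n(\theta)+o_{\mathbb P}(n^{-1})$ and $\Pi_n(\Theta\setminus\Theta_{osn})=o_{\mathbb P}(1)$. 3. (Local quadratic approximation with singularity.) There are random variables $\ell_n$, random vectors $\hat\gamma_n$ in $\mathbb R^{d^*}$ and random measurable functions $f_{n,\perp}:\Gamma_\perp\to[0,\infty)$ with $f_{n,\perp}(0)=0$ a.s. such that $$\sup_{\theta\in\Theta_{osn}}\Big|nL_n(\theta)-\Big(\ell_n+\tfrac12\|\sqrt n\hat\gamma_n\|^2-\tfrac12\|\sqrt n(\hat\gamma_n-\gamma(\theta))\|^2-f_{n,\perp}(\gamma_\perp(\theta))\Big)\Big|=o_{\mathbb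 P}(1),$$ $\sup_{\theta\in\Theta_{osn}}\|(\gamma(\theta),\gamma_\perp(\theta))\|\to0$, and $\sqrt n\hat\gamma_n=\mathbf T\mathbb V_n$, where $\mathbb V_n$ converges in distribution to $N(0,\Sigma)$ and $\mathbf T$ is the metric projection onto $T$. For large $n$, $\{(\gamma(\theta),\gamma_\perp(\theta)):\theta\in\Theta_{osn}\}=\{\gamma(\theta):\theta\in\Theta_{osn}\}\times\{\gamma_\perp(\theta):\theta\in\Theta_{osn}\}$. 4. (Prior.) $\int e^{nL_n}d\Pi<\infty$ a.s., and the image of $\Pi|_{\Theta_I^N}$ under $(\gamma,\gamma_\perp)$ has a continuous, strictly positive Lebesgue density on $B\cap(\Gamma\times\Gamma_\perp)$ for some ball $B$ about $0$. **Conclusion.** Let $Z\sim N(0,I_{d^*})$ be independent of the data and let $F_T(z)=\mathbb P(\|\mathbf TZ\|^2\le z)$. Then $$\sup_{z\in\mathbb R}\Big(\Pi_n(\{\theta:Q_n(\theta)\le z\})-\mathbb P\big(\|Z\|^2\le z\,\big|\,Z\in T-\sqrt n\hat\gamma_n\big)\Big)\le o_{\mathbb P}(1),$$ where on the right-hand probability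 $\hat\gamma_n$ is held fixed, and hence $$\sup_{z\in\mathbb R}\big(\Pi_n(\{\theta:Q_n(\theta)\le z\})-F_T(z)\big)\le o_{\mathbb P}(1).$$ If moreover $\Sigma=I_{d^*}$, then for every $\alpha\in(0,1)$ such that $F_T$ is continuous at its $\alpha$ quantile and $\xi^{mc}_{n,\alpha}=\xi^{post}_{n,\alpha}+o_{\mathbb P}(1)$, $$\liminf_{n\to\infty}\mathbb P(\Theta_I\subseteq\widehat\Theta_\alpha)\ge\alpha,$$ and the same holds for $\widehat\Theta'_\alpha$. -/

import Mathlib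

open MeasureTheory ProbabilityTheory Filter Topology
open scoped ENNReal

noncomputable section

/-- Euclidean space `ℝ^d` with its Euclidean norm. -/
abbrev Euc (d : ℕ) : Type := EuclideanSpace ℝ (Fin d)

/-! ### Stochastic order symbols

Statements "with probability approaching one" are expressed through the (outer) probability of the
exceptional event, so that suprema over uncountable sets need no separate measurability. Criterion
functions take values in `[-∞, ∞]`, because a log-likelihood may equal `-∞`. -/

/-- `X n = Y n + o_P(a n)` for extended real valued random variables. -/
def EqUpToOP {Ω : Type*} [MeasurableSpace Ω] (P : Measure Ω) (a : ℕ → ℝ)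
    (X Y : ℕ → Ω → EReal) : Prop :=
  ∀ ε : ℝ, 0 < ε →
    Tendsto (fun n : ℕ => P {ω | ¬ (X n ω ≤ Y n ω + ((ε * a n : ℝ) : EReal) ∧
      Y n ω ≤ X n ω + ((ε * a n : ℝ) : EReal))}) atTop (𝓝 0)

/-- `sup_{z ∈ ℝ} (F n ω z - G n ω z) ≤ o_P(1)`. -/
def SupDiffLeOP {Ω : Type*} [MeasurableSpace Ω] (P : Measure Ω)
    (F G : ℕ → Ω → ℝ → ℝ) : Prop :=
  ∀ ε : ℝ, 0 < ε →
    Tendsto (fun n : ℕ => P {ω | ¬ ∀ z : ℝ, F n ω z - G n ω z ≤ ε}) atTop (𝓝 0)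

/-- Inner probability of an event: the ordinary probability if the event is measurable, see
`innerProb_eq`. -/
def innerProb {Ω : Type*} [MeasurableSpace Ω] (P : Measure Ω) (s : Set Ω) : ℝ≥0∞ :=
  1 - P sᶜ

theorem innerProb_eq {Ω : Type*} [MeasurableSpace Ω] (P : Measure Ω) [IsProbabilityMeasure P]
    {s : Set Ω} (hs : NullMeasurableSet s P) : innerProb P s = P s := by
  rw [innerProb, ← prob_compl_eq_one_sub₀ hs.compl, compl_compl]

/-- The `α` quantile `inf {c ∈ ℝ : F c ≥ α}` of a distribution function. -/
def quantile (F : ℝ → ℝ) (α : ℝ) : EReal :=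
  sInf (Real.toEReal '' {c : ℝ | α ≤ F c})

/-- The distribution function of the empirical distribution of `x 0, …, x (B - 1)`. -/
def empiricalCDF {B : ℕ} (x : Fin B → EReal) (z : ℝ) : ℝ :=
  (Nat.card {b : Fin B // x b ≤ (z : EReal)} : ℝ) / (B : ℝ)

/-! ### Criterion, quasi-posterior and quasi-likelihood ratio -/

/-- The identified set: the maximizers of the population criterion `L`. -/
def identifiedSet {Θ : Type*} (L : Θ → EReal) : Set Θ :=
  {θ | L θ = ⨆ ϑ, L ϑ}

/-- The quasi-posterior `dΠ_n(θ) = e^{n L(θ)} dΠ(θ) / ∫ e^{n L} dΠ` for a realized sample criterion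
`L`. -/
def quasiPosterior {Θ : Type*} [MeasurableSpace Θ] (prior : Measure Θ) (n : ℕ) (L : Θ → EReal) :
    Measure Θ :=
  (∫⁻ θ, EReal.exp ((n : EReal) * L θ) ∂prior)⁻¹ •
    prior.withDensity (fun θ => EReal.exp ((n : EReal) * L θ))

/-- The quasi-likelihood ratio `Q_n(θ) = 2 n [L_n(θ̂) - L_n(θ)]`. -/
def qlr {Θ : Type*} (n : ℕ) (L : Θ → EReal) (θhat θ : Θ) : EReal :=
  2 * (n : EReal) * (L θhat - L θ)

/-- The distribution function `z ↦ Π_n({θ : Q_n(θ) ≤ z})` of the QLR under the quasi-posterior. -/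
def posteriorQLR {Θ : Type*} [MeasurableSpace Θ] (prior : Measure Θ) (n : ℕ) (L : Θ → EReal)
    (θhat : Θ) (z : ℝ) : ℝ :=
  (quasiPosterior prior n L).real {θ | qlr n L θhat θ ≤ (z : EReal)}

/-- The `α` quantile `ξ^mc` of the QLR over Monte Carlo draws. -/
def xiMC {Θ : Type*} (n : ℕ) (L : Θ → EReal) (θhat : Θ) {B : ℕ} (draw : Fin B → Θ) (α : ℝ) :
    EReal :=
  quantile (empiricalCDF (fun b => qlr n L θhat (draw b))) α

/-- The `α` quantile `ξ^post` of the QLR under the quasi-posterior. -/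
def xiPost {Θ : Type*} [MeasurableSpace Θ] (prior : Measure Θ) (n : ℕ) (L : Θ → EReal)
    (θhat : Θ) (α : ℝ) : EReal :=
  quantile (posteriorQLR prior n L θhat) α

/-- The confidence set `{θ : L_n(θ) ≥ ζ}`, where `ζ` is the `1 - α` quantile of the sample
criterion over the Monte Carlo draws. -/
def confSet {Θ : Type*} (L : Θ → EReal) {B : ℕ} (draw : Fin B → Θ) (α : ℝ) : Set Θ :=
  {θ | quantile (empiricalCDF (fun b => L (draw b))) (1 - α) ≤ L θ}

/-- The confidence set `{θ : Q_n(θ) ≤ ξ^mc}`, written through the quasi-likelihood ratio. -/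
def confSetQLR {Θ : Type*} (n : ℕ) (L : Θ → EReal) (θhat : Θ) {B : ℕ} (draw : Fin B → Θ)
    (α : ℝ) : Set Θ :=
  {θ | qlr n L θhat θ ≤ xiMC n L θhat draw α}

/-! ### Cones -/

/-- The metric projection onto a closed convex cone: the (unique) nearest point. -/
def coneProj {d : ℕ} (T : ProperCone ℝ (Euc d)) (v : Euc d) : Euc d :=
  (exists_norm_eq_iInf_of_complete_convex T.nonempty T.isClosed.isComplete T.convex v).choose

theorem coneProj_spec {d : ℕ} (T : ProperCone ℝ (Euc d)) (v : Euc d) :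
    coneProj T v ∈ (T : Set (Euc d)) ∧ ‖v - coneProj T v‖ = ⨅ w : (T : Set (Euc d)), ‖v - w‖ :=
  (exists_norm_eq_iInf_of_complete_convex T.nonempty T.isClosed.isComplete T.convex v).choose_spec

/-- `F_T(z) = P(‖𝐓 Z‖² ≤ z)` with `Z ∼ N(0, I)` and `𝐓` the projection onto `T`. -/
def coneCDF {d : ℕ} (T : ProperCone ℝ (Euc d)) (z : ℝ) : ℝ :=
  (stdGaussian (Euc d)).real {x | ‖coneProj T x‖ ^ 2 ≤ z}

/-- `P(‖Z‖² ≤ z | Z ∈ T - v)` with `Z ∼ N(0, I)`. -/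
def shiftedConeCDF {d : ℕ} (T : ProperCone ℝ (Euc d)) (v : Euc d) (z : ℝ) : ℝ :=
  ((stdGaussian (Euc d))[|{x | x + v ∈ T}]).real {x | ‖x‖ ^ 2 ≤ z}

/-- The sequence of sets `A n` covers the set `A`: squared distances to `A n` converge to those to
`A`, uniformly on bounded sets, and the intersections of `A n` with closed balls about the origin of
radii `r n → ∞` are (from some index on) convex, increasing, and exhaust `A` up to closure. -/
def Covers {d : ℕ} (A : ℕ → Set (Euc d)) (T : Set (Euc d)) : Prop :=
  (∀ M ε : ℝ, 0 < ε → ∀ᶠ n in atTop, ∀ b : Euc d, ‖b‖ ≤ M →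
    |(⨅ a : A n, ‖(a : Euc d) - b‖ ^ 2) - ⨅ a : T, ‖(a : Euc d) - b‖ ^ 2| ≤ ε) ∧
  ∃ (r : ℕ → ℝ) (N : ℕ), Tendsto r atTop atTop ∧
    (∀ n, N ≤ n → Convex ℝ (A n ∩ Metric.closedBall 0 (r n))) ∧
    (∀ m n, N ≤ m → m ≤ n →
      A m ∩ Metric.closedBall 0 (r m) ⊆ A n ∩ Metric.closedBall 0 (r n)) ∧
    T = closure (⋃ n ∈ Set.Ici N, A n ∩ Metric.closedBall 0 (r n))

/-! ### The assumptions -/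

/-- The local reduced-form reparameterization `θ ↦ (γ θ, γ_⊥ θ)` on the neighborhood `ΘN` of the
identified set `ΘI`, with local neighborhoods `Θos n`. Outside `ΘN` the values of `γ`, `γp` are
irrelevant. -/
structure LocalReparam {Θ : Type*} [TopologicalSpace Θ] [MeasurableSpace Θ] {d k : ℕ}
    (prior : Measure Θ) (ΘI ΘN : Set Θ) (Θos : ℕ → Set Θ)
    (γ : Θ → Euc d) (γp : Θ → Euc k) (Γ : Set (Euc d)) (Γp : Set (Euc k))
    (T : ProperCone ℝ (Euc d)) : Prop where
  nhds_N : ΘN ∈ 𝓝ˢ ΘI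
  nhds_os : ∀ n, Θos n ∈ 𝓝ˢ ΘI
  os_subset : ∀ᶠ n in atTop, Θos n ⊆ ΘN
  measurableSet_N : MeasurableSet ΘN
  measurableSet_os : ∀ n, MeasurableSet (Θos n)
  measurable_γ : Measurable γ
  measurable_γp : Measurable γp
  measurableSet_Γ : MeasurableSet Γ
  measurableSet_Γp : MeasurableSet Γp
  mapsTo : ∀ θ ∈ ΘN, γ θ ∈ Γ ∧ γp θ ∈ Γp
  eq_zero_iff : ∀ θ ∈ ΘN, (γ θ = 0 ∧ γp θ = 0) ↔ θ ∈ ΘI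
  /-- The rescaled local parameter sets cover the cone `T`. -/
  covers : Covers (fun n : ℕ => (fun θ => Real.sqrt n • γ θ) '' Θos n) (T : Set (Euc d))
  /-- The images over which one integrates are Lebesgue measurable. -/
  nullMeasurable : ∀ᶠ n in atTop, NullMeasurableSet (γ '' Θos n) volume ∧
    NullMeasurableSet (γp '' Θos n) volume
  /-- `Θos n` is locally determined by the reduced form, which is what makes the change of variables
  `θ ↦ (γ θ, γp θ)` on `Θos n` legitimate: on balls of radius `r n → ∞` for `√n γ`, prior almost
  every `θ` whose reduced form is attained on `Θos n` belongs to `Θos n`. -/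
  saturated : ∃ r : ℕ → ℝ, Tendsto r atTop atTop ∧ ∀ᶠ n : ℕ in atTop,
    prior {θ | θ ∈ ΘN ∧ Real.sqrt n * ‖γ θ‖ ≤ r n ∧
      (γ θ, γp θ) ∈ (fun ϑ => (γ ϑ, γp ϑ)) '' Θos n ∧ θ ∉ Θos n} = 0

/-- Posterior contraction. -/
structure PosteriorContraction {Ω Θ : Type*} [MeasurableSpace Ω] [MeasurableSpace Θ]
    (P : Measure Ω) (prior : Measure Θ) (L : ℕ → Ω → Θ → EReal) (θhat : ℕ → Ω → Θ)
    (Θos : ℕ → Set Θ) : Prop where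
  approx_max : EqUpToOP P (fun n => (n : ℝ)⁻¹) (fun n ω => L n ω (θhat n ω))
    (fun n ω => ⨆ θ ∈ Θos n, L n ω θ)
  contraction : ∀ ε : ℝ, 0 < ε →
    Tendsto (fun n : ℕ => P {ω | ENNReal.ofReal ε < quasiPosterior prior n (L n ω) (Θos n)ᶜ})
      atTop (𝓝 0)

/-- The local expansion
`ℓ + ½ ‖√n γ̂‖² - ½ ‖√n (γ̂ - γ θ)‖² - f_⊥(γ_⊥ θ)` of `n L_n(θ)`. -/
def localExpansion {Θ : Type*} {d k : ℕ} (n : ℕ) (ℓ : ℝ) (γhat : Euc d) (f : Euc k → ℝ)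
    (γ : Θ → Euc d) (γp : Θ → Euc k) (θ : Θ) : ℝ :=
  ℓ + 1 / 2 * ‖Real.sqrt n • γhat‖ ^ 2 - 1 / 2 * ‖Real.sqrt n • (γhat - γ θ)‖ ^ 2 - f (γp θ)

/-- Local quadratic approximation with singularity. -/
structure LocalQuadraticSingular {Ω Θ : Type*} [MeasurableSpace Ω] {d k : ℕ}
    (P : Measure Ω) [IsProbabilityMeasure P] (L : ℕ → Ω → Θ → EReal) (Θos : ℕ → Set Θ)
    (γ : Θ → Euc d) (γp : Θ → Euc k) (Γp : Set (Euc k)) (T : ProperCone ℝ (Euc d))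
    (ℓ : ℕ → Ω → ℝ) (γhat V : ℕ → Ω → Euc d) (f : ℕ → Ω → Euc k → ℝ)
    (S : Matrix (Fin d) (Fin d) ℝ) : Prop where
  measurable_ℓ : ∀ n, Measurable (ℓ n)
  measurable_γhat : ∀ n, Measurable (γhat n)
  measurable_f : ∀ n, Measurable (Function.uncurry (f n))
  f_nonneg : ∀ n ω, ∀ y ∈ Γp, 0 ≤ f n ω y
  f_zero : ∀ n, ∀ᵐ ω ∂P, f n ω 0 = 0
  expansion : ∀ ε : ℝ, 0 < ε →
    Tendsto (fun n : ℕ => P {ω | ¬ ∀ θ ∈ Θos n,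
      (n : EReal) * L n ω θ ≤
        ((localExpansion n (ℓ n ω) (γhat n ω) (f n ω) γ γp θ + ε : ℝ) : EReal) ∧
      ((localExpansion n (ℓ n ω) (γhat n ω) (f n ω) γ γp θ - ε : ℝ) : EReal) ≤
        (n : EReal) * L n ω θ}) atTop (𝓝 0)
  shrink : ∀ ε : ℝ, 0 < ε → ∀ᶠ n in atTop, ∀ θ ∈ Θos n, ‖(γ θ, γp θ)‖ ≤ ε
  γhat_eq : ∀ n : ℕ, 1 ≤ n → ∀ᵐ ω ∂P, Real.sqrt n • γhat n ω = coneProj T (V n ω)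
  posSemidef : S.PosSemidef
  weak_limit : TendstoInDistribution V atTop (fun x : Euc d => x) (fun _ => P)
    (multivariateGaussian 0 S)
  product : ∀ᶠ n in atTop,
    (fun θ => (γ θ, γp θ)) '' Θos n = (γ '' Θos n) ×ˢ (γp '' Θos n)

/-- Prior with singularity: the quasi-posterior is proper, and near the origin the image of the
prior (restricted to `ΘN`) under `θ ↦ (γ θ, γ_⊥ θ)` has a continuous strictly positive Lebesgue
density on `Γ × Γ_⊥`. (Balls of the product norm and Euclidean balls of `ℝ^{d+k}` are
interchangeable here, `δ` being arbitrary.) -/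
structure PriorSingular {Ω Θ : Type*} [MeasurableSpace Ω] [MeasurableSpace Θ] {d k : ℕ}
    (P : Measure Ω) (prior : Measure Θ) (L : ℕ → Ω → Θ → EReal) (ΘN : Set Θ)
    (γ : Θ → Euc d) (γp : Θ → Euc k) (Γ : Set (Euc d)) (Γp : Set (Euc k)) : Prop where
  proper : ∀ n : ℕ, 1 ≤ n → ∀ᵐ ω ∂P, ∫⁻ θ, EReal.exp ((n : EReal) * L n ω θ) ∂prior < ∞
  density : ∃ δ : ℝ, 0 < δ ∧ ∃ p : Euc d × Euc k → ℝ,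
    ContinuousOn p (Metric.ball 0 δ ∩ Γ ×ˢ Γp) ∧
    (∀ x ∈ Metric.ball 0 δ ∩ Γ ×ˢ Γp, 0 < p x) ∧
    ((prior.restrict ΘN).map (fun θ => (γ θ, γp θ))).restrict (Metric.ball 0 δ ∩ Γ ×ˢ Γp) =
      (volume.restrict (Metric.ball 0 δ ∩ Γ ×ˢ Γp)).withDensity (fun x => ENNReal.ofReal (p x))

/-- Monte Carlo convergence: `ξ^mc = ξ^post + o_P(1)`. -/
def MCConvergence {Ω Θ : Type*} [MeasurableSpace Ω] [MeasurableSpace Θ]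
    (P : Measure Ω) (prior : Measure Θ) (L : ℕ → Ω → Θ → EReal) (θhat : ℕ → Ω → Θ)
    (B : ℕ → ℕ) (draw : ∀ n, Ω → Fin (B n) → Θ) (α : ℝ) : Prop :=
  EqUpToOP P (fun _ => 1) (fun n ω => xiMC n (L n ω) (θhat n ω) (draw n ω) α)
    (fun n ω => xiPost prior n (L n ω) (θhat n ω) α)

end

/-! ### Projection onto a closed convex cone -/

section ConeProjection

variable {d : ℕ} (T : ProperCone ℝ (Euc d))

/-! On `Θos n` the quadratic expansion makes the quasi-posterior weight proportional, up to a factor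
close to 1, to `exp (-‖√n γ̂ - √n γ‖² / 2) * exp (-f γ_⊥)` times the prior. In the reduced form the
prior is nearly a constant multiple of Lebesgue measure and the image of `Θos n` is a product. Hence
the integral over the singular directions is a common factor, and the posterior of `√n γ` is nearly
a Gaussian centred at `√n γ̂`, truncated to sets that fill out `T`. Since `f ≥ 0`, the QLR is at
least `‖√n γ̂ - √n γ‖² - o(1)`, which gives the one-sided bound by `shiftedConeCDF`
(`LocalReparam.exists_setLIntegral_le`, `ExpansionHolds.posteriorQLR_le`).

The passage to `F_T` is a Gaussian correlation inequality. Because `‖𝐓x‖ ≤ ‖x‖`, it suffices that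
the events `‖𝐓Z‖² ≤ z` and `Z + v ∈ T` are nonpositively correlated
(`stdGaussian_inter_shifted_cone_le`). The indicator of the second event is the limit of `exp (-m
dist(x + v, T)²)`, whose gradients point into the dual cone of `T`. Along the dual cone `‖𝐓x‖` can
only grow, so the indicator of the first event decreases along all these gradients. Such a pair is
nonpositively correlated: rotate an independent copy of the Gaussian into the second argument and
check the sign of the derivative (`integral_mul_le_of_antitone_along_gradient`).

For coverage, on the identified set the QLR is at most `‖√n γ̂‖² + o(1) = ‖𝐓V_n‖² + o(1)`, whose
limit law is `F_T` when the covariance is the identity. The domination keeps the posterior quantile,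
and with it the Monte Carlo quantile, above the quantile of `F_T` up to `o(1)`. -/

theorem coneProj_mem (x : Euc d) : coneProj T x ∈ T := (coneProj_spec T x).1

theorem inner_sub_coneProj_sub_le (x : Euc d) {t : Euc d} (ht : t ∈ T) :
    inner ℝ (x - coneProj T x) (t - coneProj T x) ≤ 0 :=
  (norm_eq_iInf_iff_real_inner_le_zero T.convex (coneProj_mem T x)).1 (coneProj_spec T x).2 t ht

/-- Testing the variational inequality at `0` and at twice the projection gives the two opposite
signs. -/
theorem inner_sub_coneProj_self (x : Euc d) :
    inner ℝ (x - coneProj T x) (coneProj T x) = 0 := by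
  have h0 := inner_sub_coneProj_sub_le T x T.zero_mem
  have h2 := inner_sub_coneProj_sub_le T x (T.add_mem (coneProj_mem T x) (coneProj_mem T x))
  rw [add_sub_cancel_right] at h2
  rw [zero_sub, inner_neg_right] at h0
  linarith

/-- The polar-cone half of Moreau's decomposition; it gives the direction of the gradients of the
distance to `T`. -/
theorem inner_sub_coneProj_le (x : Euc d) {t : Euc d} (ht : t ∈ T) :
    inner ℝ (x - coneProj T x) t ≤ 0 := by
  have h := inner_sub_coneProj_sub_le T x ht
  rwa [inner_sub_right, inner_sub_coneProj_self, sub_zero] at h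

theorem coneProj_of_mem {x : Euc d} (hx : x ∈ T) : coneProj T x = x := by
  have h := inner_sub_coneProj_sub_le T x hx
  rw [real_inner_self_eq_norm_sq] at h
  have : ‖x - coneProj T x‖ = 0 := by nlinarith [norm_nonneg (x - coneProj T x)]
  exact (sub_eq_zero.1 (norm_eq_zero.1 this)).symm

theorem inner_coneProj_self (x : Euc d) : inner ℝ x (coneProj T x) = ‖coneProj T x‖ ^ 2 := by
  have h := inner_sub_coneProj_self T x
  rw [inner_sub_left, real_inner_self_eq_norm_sq] at h
  linarith

/-- Writing `𝐓` for the projection, `‖𝐓x‖² = ⟪x, 𝐓x⟫ ≤ ⟪x + u, 𝐓x⟫ ≤ ⟪𝐓(x + u), 𝐓x⟫`; Cauchy–Schwarz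
concludes. This is the monotonicity along the dual cone behind the correlation inequality. -/
theorem norm_coneProj_le_norm_add (x : Euc d) {u : Euc d} (hu : ∀ t ∈ T, 0 ≤ inner ℝ u t) :
    ‖coneProj T x‖ ≤ ‖coneProj T (x + u)‖ := by
  have h1 := inner_coneProj_self T x
  have h2 := inner_sub_coneProj_le T (x + u) (coneProj_mem T x)
  have h3 := hu _ (coneProj_mem T x)
  have h4 := real_inner_le_norm (coneProj T (x + u)) (coneProj T x)
  rw [inner_sub_left, inner_add_left] at h2
  by_contra! h
  have h5 : 0 < ‖coneProj T x‖ := (norm_nonneg _).trans_lt h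
  nlinarith

theorem norm_coneProj_le (x : Euc d) : ‖coneProj T x‖ ≤ ‖x‖ := by
  have h1 := inner_coneProj_self T x
  have h4 := real_inner_le_norm x (coneProj T x)
  by_contra! h
  have h5 : 0 < ‖coneProj T x‖ := (norm_nonneg _).trans_lt h
  nlinarith

theorem norm_coneProj_sub_le (x y : Euc d) : ‖coneProj T x - coneProj T y‖ ≤ ‖x - y‖ := by
  have h1 := inner_sub_coneProj_sub_le T x (coneProj_mem T y)
  have h2 := inner_sub_coneProj_sub_le T y (coneProj_mem T x)
  have h3 : ‖coneProj T x - coneProj T y‖ ^ 2 ≤ inner ℝ (x - y) (coneProj T x - coneProj T y) := by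
    rw [← real_inner_self_eq_norm_sq]
    simp only [inner_sub_left, inner_sub_right] at h1 h2 ⊢
    rw [real_inner_comm (coneProj T x) x] at *
    linarith [real_inner_comm (coneProj T x) (coneProj T y)]
  have h4 := real_inner_le_norm (x - y) (coneProj T x - coneProj T y)
  by_contra! h
  have h5 : 0 < ‖coneProj T x - coneProj T y‖ := (norm_nonneg _).trans_lt h
  nlinarith

theorem continuous_coneProj : Continuous (coneProj T) :=
  (LipschitzWith.of_dist_le_mul (K := 1) fun x y => by
    simpa [dist_eq_norm] using norm_coneProj_sub_le T x y).continuous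

theorem norm_sub_coneProj_le (x : Euc d) {t : Euc d} (ht : t ∈ T) :
    ‖x - coneProj T x‖ ≤ ‖x - t‖ := by
  rw [(coneProj_spec T x).2]
  exact ciInf_le (f := fun w : (T : Set (Euc d)) => ‖x - w‖)
    ⟨0, by rintro _ ⟨w, rfl⟩; exact norm_nonneg _⟩ ⟨t, ht⟩

/-- The gradient of the squared distance to a cone is twice the residual. -/
theorem hasGradientAt_normSq_sub_coneProj (x : Euc d) :
    HasGradientAt (fun y => ‖y - coneProj T y‖ ^ 2) ((2 : ℝ) • (x - coneProj T x)) x := by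
  -- The projection of `a` is a competitor in the distance from `b`. Used in both orders, this
  -- bounds the increment from above and from below.
  have key : ∀ a b : Euc d, ‖b - coneProj T b‖ ^ 2 - ‖a - coneProj T a‖ ^ 2
      ≤ 2 * inner ℝ (a - coneProj T a) (b - a) + ‖b - a‖ ^ 2 := by
    intro a b
    have h := norm_sub_coneProj_le T b (coneProj_mem T a)
    have h2 : ‖b - coneProj T a‖ ^ 2 = ‖a - coneProj T a‖ ^ 2
        + 2 * inner ℝ (a - coneProj T a) (b - a) + ‖b - a‖ ^ 2 := by
      rw [← norm_add_sq_real]; congr 2; abel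
    have h3 : ‖b - coneProj T b‖ ^ 2 ≤ ‖b - coneProj T a‖ ^ 2 := by gcongr
    linarith
  rw [hasGradientAt_iff_isLittleO]
  refine Asymptotics.IsBigO.trans_isLittleO (g := fun y => ‖y - x‖ ^ 2) ?_ ?_
  -- The lower bound has the residual at `y` in place of `x`. Residuals are 2-Lipschitz, so this
  -- costs `2 * 2 * ‖y - x‖²`, and `key` costs one more.
  · refine Asymptotics.IsBigO.of_bound 5 (Eventually.of_forall fun y => ?_)
    have h1 := key x y
    have h2 := key y x
    have h3 : ‖(y - coneProj T y) - (x - coneProj T x)‖ ≤ 2 * ‖y - x‖ := by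
      calc _ = ‖(y - x) - (coneProj T y - coneProj T x)‖ := by congr 1; abel
        _ ≤ ‖y - x‖ + ‖coneProj T y - coneProj T x‖ := norm_sub_le _ _
        _ ≤ _ := by linarith [norm_coneProj_sub_le T y x]
    have h4 := (abs_le.1 ((abs_real_inner_le_norm
      ((y - coneProj T y) - (x - coneProj T x)) (y - x)).trans
        (mul_le_mul_of_nonneg_right h3 (norm_nonneg _)))).1
    rw [inner_sub_left] at h4
    have h5 : inner ℝ (y - coneProj T y) (x - y) = - inner ℝ (y - coneProj T y) (y - x) := by
      rw [← inner_neg_right, neg_sub]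
    rw [h5, norm_sub_rev x y] at h2
    rw [real_inner_smul_left, Real.norm_eq_abs, Real.norm_eq_abs, abs_of_nonneg (sq_nonneg ‖y - x‖),
      abs_le]
    constructor <;> nlinarith [norm_nonneg (y - x)]
  · have : (fun y => ‖y - x‖ ^ 2) =o[𝓝 x] fun y => ‖y - x‖ ^ 1 := by
      have h := (Asymptotics.isLittleO_pow_pow (𝕜 := ℝ) (m := 1) (n := 2) (by norm_num))
      refine h.comp_tendsto (k := fun y => ‖y - x‖) ?_
      have : Continuous fun y : Euc d => ‖y - x‖ := by fun_prop
      simpa using this.tendsto x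
    simpa using this.norm_right

end ConeProjection

/-! ### A Gaussian association inequality -/

section Association

variable {E : Type*} [NormedAddCommGroup E] [InnerProductSpace ℝ E] [FiniteDimensional ℝ E]
  [MeasurableSpace E] [BorelSpace E]

theorem integrable_norm_stdGaussian : Integrable (fun x : E => ‖x‖) (stdGaussian E) :=
  (IsGaussian.integrable_id (μ := stdGaussian E)).norm

/-- A function decreasing in the direction `a` has nonnegative Gaussian correlation, after a reversal of
its argument, with the linear form `⟪a, ·⟫`. -/
theorem integral_mul_inner_nonneg {f : E → ℝ} (hf : Measurable f) (hf1 : ∀ x, |f x| ≤ 1) (a c : E)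
    (hfa : ∀ x, ∀ s : ℝ, 0 ≤ s → f (x + s • a) ≤ f x) {s : ℝ} (hs : 0 ≤ s) :
    0 ≤ ∫ w, f (c - s • w) * inner ℝ a w ∂(stdGaussian E) := by
  -- The reflection in the hyperplane orthogonal to `a` preserves the Gaussian and flips the sign of
  -- `⟪a, w⟫`.
  set R : E ≃ₗᵢ[ℝ] E := (ℝ ∙ a)ᗮ.reflection with hR
  have hRa : R a = -a := Submodule.reflection_orthogonalComplement_singleton_eq_neg a
  have hinner : ∀ w, inner ℝ a (R w) = - inner ℝ a w := by
    intro w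
    have h : inner ℝ (R a) (R w) = inner ℝ a w := R.inner_map_map a w
    rw [hRa, inner_neg_left] at h
    linarith
  have hint : Integrable (fun w => f (c - s • w) * inner ℝ a w) (stdGaussian E) := by
    refine Integrable.mono' (integrable_norm_stdGaussian.const_mul ‖a‖)
      (by fun_prop) (Eventually.of_forall fun w => ?_)
    rw [norm_mul, Real.norm_eq_abs]
    calc _ ≤ 1 * (‖a‖ * ‖w‖) := by
          gcongr
          · exact hf1 _
          · exact norm_inner_le_norm a w
      _ = _ := one_mul _
  have hmp : MeasurePreserving R (stdGaussian E) (stdGaussian E) :=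
    ⟨R.continuous.measurable, stdGaussian_map R⟩
  have hint2 : Integrable (fun w => f (c - s • R w) * inner ℝ a (R w)) (stdGaussian E) :=
    hmp.integrable_comp_of_integrable hint
  have h2 : ∫ w, f (c - s • R w) * inner ℝ a (R w) ∂(stdGaussian E)
      = ∫ w, f (c - s • w) * inner ℝ a w ∂(stdGaussian E) :=
    hmp.integral_comp' (f := R.toHomeomorph.toMeasurableEquiv)
      (fun w => f (c - s • w) * inner ℝ a w)
  -- Paired with its reflection, the integrand is `(f (c - s w) - f (c - s R w)) * ⟪a, w⟫`. The two
  -- arguments of `f` differ by a multiple of `a` with the sign of `⟪a, w⟫`, so the product is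
  -- pointwise nonnegative.
  suffices h : 0 ≤ ∫ w, (f (c - s • w) * inner ℝ a w + f (c - s • R w) * inner ℝ a (R w))
      ∂(stdGaussian E) by
    rw [integral_add hint hint2, h2] at h
    linarith
  refine integral_nonneg fun w => ?_
  by_cases ha : a = 0
  · simp [ha]
  have ha' : 0 < ‖a‖ ^ 2 := by positivity
  have hRw : R w = w - (2 * (inner ℝ a w / ‖a‖ ^ 2)) • a := by
    rw [hR, Submodule.reflection_orthogonal_apply, Submodule.reflection_singleton_apply]
    simp only [RCLike.ofReal_real_eq_id, id]
    module
  rw [hinner, hRw]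
  rcases le_total 0 (inner ℝ a w) with h | h
  · have := hfa (c - s • w) (s * (2 * (inner ℝ a w / ‖a‖ ^ 2))) (by positivity)
    have e : c - s • w + (s * (2 * (inner ℝ a w / ‖a‖ ^ 2))) • a
        = c - s • (w - (2 * (inner ℝ a w / ‖a‖ ^ 2)) • a) := by module
    rw [e] at this
    simp only [Pi.zero_apply]
    nlinarith
  · have := hfa (c - s • (w - (2 * (inner ℝ a w / ‖a‖ ^ 2)) • a))
      (s * (2 * (-inner ℝ a w / ‖a‖ ^ 2))) (by
        have := neg_nonneg.2 h
        positivity)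
    have e : c - s • (w - (2 * (inner ℝ a w / ‖a‖ ^ 2)) • a)
        + (s * (2 * (-inner ℝ a w / ‖a‖ ^ 2))) • a = c - s • w := by module
    rw [e] at this
    simp only [Pi.zero_apply]
    nlinarith

/-- If a bounded function `f` decreases along all gradients of a bounded Lipschitz function `g`,
then `f` and `g` are nonpositively correlated under the standard Gaussian measure. -/
theorem integral_mul_le_of_antitone_along_gradient {f g : E → ℝ} {a : E → E} {C : ℝ}
    (hf : Measurable f) (hf1 : ∀ x, |f x| ≤ 1) (hg1 : ∀ x, |g x| ≤ 1)
    (hga : ∀ x, HasGradientAt g (a x) x) (ha : Continuous a) (haC : ∀ x, ‖a x‖ ≤ C)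
    (hfa : ∀ x y, ∀ s : ℝ, 0 ≤ s → f (x + s • a y) ≤ f x) :
    ∫ x, f x * g x ∂(stdGaussian E) ≤ (∫ x, f x ∂(stdGaussian E)) * ∫ x, g x ∂(stdGaussian E) := by
  set μ := stdGaussian E with hμ
  have hgc : Continuous g := continuous_iff_continuousAt.2 fun x => (hga x).continuousAt
  have hgm : Measurable g := hgc.measurable
  have ham : Measurable a := ha.measurable
  -- Interpolation by rotation: the integral of `F t` is `∫ f g` at `t = 0` and `(∫ f) (∫ g)` at `t
  -- = π / 2`.
  set F : ℝ → E × E → ℝ := fun t p => f p.1 * g (Real.cos t • p.1 + Real.sin t • p.2)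
  set F' : ℝ → E × E → ℝ := fun t p => f p.1 *
    inner ℝ (a (Real.cos t • p.1 + Real.sin t • p.2)) (-Real.sin t • p.1 + Real.cos t • p.2)
  have hC : 0 ≤ C := (norm_nonneg _).trans (haC 0)
  have hF : ∀ t, Measurable (F t) := fun t => by fun_prop
  have hF' : ∀ t, Measurable (F' t) := fun t => by fun_prop
  have hbd : Integrable (fun p : E × E => C * (‖p.1‖ + ‖p.2‖)) (μ.prod μ) :=
    ((integrable_norm_stdGaussian.comp_fst μ).add (integrable_norm_stdGaussian.comp_snd μ)).const_mul C
  have hder : ∀ t, HasDerivAt (fun t => ∫ p, F t p ∂(μ.prod μ)) (∫ p, F' t p ∂(μ.prod μ)) t := by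
    intro t
    refine (hasDerivAt_integral_of_dominated_loc_of_deriv_le (s := Set.univ)
      (bound := fun p => C * (‖p.1‖ + ‖p.2‖)) univ_mem
      (Eventually.of_forall fun t => (hF t).aestronglyMeasurable) ?_
      (hF' t).aestronglyMeasurable ?_ hbd ?_).2
    · refine Integrable.mono' (integrable_const (1 : ℝ)) (hF t).aestronglyMeasurable
        (Eventually.of_forall fun p => ?_)
      rw [norm_mul]
      exact mul_le_one₀ (hf1 _) (norm_nonneg _) (hg1 _)
    · refine Eventually.of_forall fun p t _ => ?_
      rw [norm_mul]
      calc _ ≤ 1 * (‖a (Real.cos t • p.1 + Real.sin t • p.2)‖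
            * ‖-Real.sin t • p.1 + Real.cos t • p.2‖) := by
            gcongr
            · exact hf1 _
            · exact norm_inner_le_norm _ _
        _ ≤ 1 * (C * (1 * ‖p.1‖ + 1 * ‖p.2‖)) := by
            gcongr
            · exact haC _
            · refine (norm_add_le _ _).trans ?_
              rw [norm_smul, norm_smul]
              gcongr
              · rw [norm_neg]; exact Real.abs_sin_le_one t
              · exact Real.abs_cos_le_one t
        _ = _ := by ring
    · refine Eventually.of_forall fun p t _ => ?_
      have h1 : HasDerivAt (fun t => Real.cos t • p.1 + Real.sin t • p.2)
          (-Real.sin t • p.1 + Real.cos t • p.2) t :=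
        ((Real.hasDerivAt_cos t).smul_const p.1).add ((Real.hasDerivAt_sin t).smul_const p.2)
      have h2 := (hga (Real.cos t • p.1 + Real.sin t • p.2)).hasFDerivAt.comp_hasDerivAt t h1
      simpa [F, F'] using h2.const_mul (f p.1)
  have hnn : ∀ t, 0 ≤ Real.sin t → 0 ≤ ∫ p, F' t p ∂(μ.prod μ) := by
    intro t ht
    -- In the rotated coordinates, which are again independent Gaussians, the gradient depends on
    -- the first one only. Freezing it leaves the one-direction inequality
    -- `integral_mul_inner_nonneg`.
    set G : E × E → ℝ := fun q => f (Real.cos t • q.1 - Real.sin t • q.2) * inner ℝ (a q.1) q.2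
    have hG : Measurable G := by fun_prop
    have hrot := IsGaussian.map_rotation_eq_self (μ := μ) (by simp [hμ]) t
    have hFG : ∀ p, F' t p = G (ContinuousLinearMap.rotation t p) := by
      intro p
      simp only [F', G, ContinuousLinearMap.rotation_apply]
      congr 2
      have := Real.sin_sq_add_cos_sq t
      rw [smul_add, smul_add, smul_smul, smul_smul, smul_smul, smul_smul]
      trans (Real.sin t ^ 2 + Real.cos t ^ 2) • p.1
      · rw [this, one_smul]
      · module
    have e : ∫ p, F' t p ∂(μ.prod μ) = ∫ q, G q ∂(μ.prod μ) := by
      conv_rhs => rw [← hrot]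
      rw [integral_map (by fun_prop) hG.aestronglyMeasurable]
      simp only [hFG]
    rw [e, integral_prod]
    · exact integral_nonneg fun u => integral_mul_inner_nonneg hf hf1 (a u) (Real.cos t • u)
        (fun x s hs => hfa x u s hs) ht
    · refine Integrable.mono' ((integrable_norm_stdGaussian.comp_snd μ).const_mul C)
        hG.aestronglyMeasurable (Eventually.of_forall fun p => ?_)
      rw [norm_mul]
      calc _ ≤ 1 * (C * ‖p.2‖) := by
            gcongr
            · exact hf1 _
            · exact (norm_inner_le_norm _ _).trans (by gcongr; exact haC _)
        _ = _ := by ring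
  have hmono : MonotoneOn (fun t => ∫ p, F t p ∂(μ.prod μ)) (Set.Icc 0 (Real.pi / 2)) := by
    refine monotoneOn_of_deriv_nonneg (convex_Icc _ _)
      (fun t _ => (hder t).continuousAt.continuousWithinAt)
      (fun t _ => (hder t).differentiableAt.differentiableWithinAt) fun t ht => ?_
    rw [(hder t).deriv]
    rw [interior_Icc] at ht
    exact hnn t (Real.sin_nonneg_of_nonneg_of_le_pi ht.1.le (by linarith [ht.2, Real.pi_pos]))
  have h := hmono (Set.left_mem_Icc.2 (by positivity)) (Set.right_mem_Icc.2 (by positivity))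
    (by positivity : (0 : ℝ) ≤ Real.pi / 2)
  simp only [F, Real.cos_zero, Real.sin_zero, Real.cos_pi_div_two, Real.sin_pi_div_two, zero_smul,
    one_smul, add_zero, zero_add] at h
  rw [integral_prod_mul, integral_fun_fst (fun x => f x * g x)] at h
  simpa using h

end Association

/-! ### Stochastic dominance for Gaussian vectors on shifted cones -/

section Dominance

variable {d : ℕ} (T : ProperCone ℝ (Euc d))

theorem measurableSet_norm_coneProj_le (z : ℝ) : MeasurableSet {x | ‖coneProj T x‖ ^ 2 ≤ z} :=
  (isClosed_le ((continuous_coneProj T).norm.pow 2) continuous_const).measurableSet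

theorem isClosed_shifted_cone (v : Euc d) : IsClosed {x | x + v ∈ T} :=
  T.isClosed.preimage (by fun_prop : Continuous fun x : Euc d => x + v)

/-- The indicator of the shifted cone is replaced by a smooth penalty on the distance to it, the
association inequality is applied, and the penalty is sent to infinity. -/
theorem stdGaussian_inter_shifted_cone_le (v : Euc d) (z : ℝ) :
    (stdGaussian (Euc d)).real ({x | ‖coneProj T x‖ ^ 2 ≤ z} ∩ {x | x + v ∈ T}) ≤
      (stdGaussian (Euc d)).real {x | ‖coneProj T x‖ ^ 2 ≤ z} *
        (stdGaussian (Euc d)).real {x | x + v ∈ T} := by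
  set μ := stdGaussian (Euc d)
  set A : Set (Euc d) := {x | ‖coneProj T x‖ ^ 2 ≤ z} with hA
  set K : Set (Euc d) := {x | x + v ∈ T} with hK
  have hAm : MeasurableSet A := measurableSet_norm_coneProj_le T z
  have hKm : MeasurableSet K := (isClosed_shifted_cone T v).measurableSet
  set f : Euc d → ℝ := A.indicator 1 with hf
  set r : Euc d → Euc d := fun x => (x + v) - coneProj T (x + v) with hr
  have hrc : Continuous r := by
    have := continuous_coneProj T
    fun_prop
  set g : ℕ → Euc d → ℝ := fun m x => Real.exp (-((m : ℝ) + 1) * ‖r x‖ ^ 2) with hg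
  have hg0 : ∀ m x, 0 ≤ g m x := fun m x => (Real.exp_pos _).le
  have hg1 : ∀ m x, |g m x| ≤ 1 := by
    intro m x
    rw [abs_of_nonneg (hg0 m x), Real.exp_le_one_iff]
    have : 0 ≤ ((m : ℝ) + 1) * ‖r x‖ ^ 2 := by positivity
    linarith
  have hgc : ∀ m, Continuous (g m) := fun m => by fun_prop
  have hfm : Measurable f := measurable_one.indicator hAm
  have hf1 : ∀ x, |f x| ≤ 1 := by
    intro x
    by_cases hx : x ∈ A <;> simp [hf, hx]
  have key : ∀ m, ∫ x, f x * g m x ∂μ ≤ (∫ x, f x ∂μ) * ∫ x, g m x ∂μ := by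
    intro m
    refine integral_mul_le_of_antitone_along_gradient (C := 2 * ((m : ℝ) + 1))
      (a := fun x => (g m x * (-((m : ℝ) + 1) * 2)) • r x) hfm hf1 (hg1 m) ?_ ?_ ?_ ?_
    · intro x
      have h1 : HasFDerivAt (fun x => ‖r x‖ ^ 2) _ x :=
        HasFDerivAt.comp (g := fun y => ‖y - coneProj T y‖ ^ 2) x
          (hasGradientAt_normSq_sub_coneProj T (x + v)).hasFDerivAt
          ((hasFDerivAt_id x).add_const v)
      have h2 := (h1.const_mul (-((m : ℝ) + 1))).exp
      rw [hasGradientAt_iff_hasFDerivAt]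
      refine h2.congr_fderiv ?_
      ext y
      simp [hg, hr]
      ring
    · have := hgc m
      fun_prop
    · intro x
      rw [norm_smul, Real.norm_eq_abs, abs_mul, abs_mul, abs_neg, abs_of_nonneg (hg0 m x),
        abs_of_nonneg (by positivity : (0 : ℝ) ≤ (m : ℝ) + 1), abs_two]
      -- The coefficient `m + 1 ≥ 1` ensures `exp ((m + 1) ρ²) ≥ 1 + ρ² ≥ ρ`.
      have h1 : g m x * ‖r x‖ ≤ 1 := by
        have h2 : ‖r x‖ ≤ Real.exp (((m : ℝ) + 1) * ‖r x‖ ^ 2) := by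
          have := Real.add_one_le_exp (((m : ℝ) + 1) * ‖r x‖ ^ 2)
          have h3 : 0 ≤ (m : ℝ) * ‖r x‖ ^ 2 := by positivity
          nlinarith [sq_nonneg (‖r x‖ - 1)]
        calc g m x * ‖r x‖ ≤ g m x * Real.exp (((m : ℝ) + 1) * ‖r x‖ ^ 2) := by
              gcongr
          _ = 1 := by
              rw [hg, ← Real.exp_add, neg_mul, neg_add_cancel, Real.exp_zero]
      have : 0 ≤ (m : ℝ) := by positivity
      nlinarith
    · intro x y s hs
      -- The scalar is nonpositive and `r y` lies in the polar cone, so the increment lies in the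
      -- dual cone, along which the projected norm grows.
      have hmem : x + s • (g m y * (-((m : ℝ) + 1) * 2)) • r y ∈ A → x ∈ A := by
        intro h
        refine le_trans ?_ (show _ ≤ z from h)
        gcongr
        refine norm_coneProj_le_norm_add T x fun t ht => ?_
        rw [smul_smul, inner_smul_left]
        have h1 : inner ℝ (r y) t ≤ 0 := inner_sub_coneProj_le T (y + v) ht
        have h2 : 0 ≤ s * g m y * ((m : ℝ) + 1) := by
          have := hg0 m y
          positivity
        simp only [conj_trivial]
        nlinarith
      by_cases h : x + s • (g m y * (-((m : ℝ) + 1) * 2)) • r y ∈ A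
      · simp only [hf, Set.indicator_of_mem h, Set.indicator_of_mem (hmem h), Pi.one_apply, le_refl]
      · simp only [hf, Set.indicator_of_notMem h]
        exact Set.indicator_nonneg (fun _ _ => zero_le_one) x
  have hlim : ∀ x, Tendsto (fun m => g m x) atTop (𝓝 (K.indicator 1 x)) := by
    intro x
    by_cases hx : x ∈ K
    · have : r x = 0 := by rw [hr]; simp only; rw [coneProj_of_mem T hx, sub_self]
      simp [hg, this, hx]
    · rw [Set.indicator_of_notMem hx]
      have hpos : 0 < ‖r x‖ ^ 2 := by
        have : r x ≠ 0 := by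
          intro h
          apply hx
          have h2 := coneProj_mem T (x + v)
          rwa [← sub_eq_zero.1 h] at h2
        positivity
      have h1 : Tendsto (fun m : ℕ => ((m : ℝ) + 1) * ‖r x‖ ^ 2) atTop atTop :=
        (tendsto_natCast_atTop_atTop.atTop_add (tendsto_const_nhds (x := (1 : ℝ)))).atTop_mul_const
          hpos
      exact (Real.tendsto_exp_neg_atTop_nhds_zero.comp h1).congr fun m => by
        simp only [hg, Function.comp, neg_mul]
  have hl1 : Tendsto (fun m => ∫ x, g m x ∂μ) atTop (𝓝 (∫ x, K.indicator 1 x ∂μ)) :=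
    tendsto_integral_of_dominated_convergence (fun _ => 1)
      (fun m => (hgc m).aestronglyMeasurable) (integrable_const _)
      (fun m => Eventually.of_forall (hg1 m)) (Eventually.of_forall hlim)
  have hl2 : Tendsto (fun m => ∫ x, f x * g m x ∂μ) atTop (𝓝 (∫ x, f x * K.indicator 1 x ∂μ)) := by
    refine tendsto_integral_of_dominated_convergence (fun _ => 1)
      (fun m => (hfm.mul (hgc m).measurable).aestronglyMeasurable) (integrable_const _)
      (fun m => Eventually.of_forall fun x => ?_)
      (Eventually.of_forall fun x => (hlim x).const_mul (f x))
    rw [norm_mul]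
    exact mul_le_one₀ (hf1 x) (norm_nonneg _) (hg1 m x)
  have h := le_of_tendsto_of_tendsto' hl2 (hl1.const_mul _) key
  have e : ∀ x, f x * K.indicator 1 x = (A ∩ K).indicator 1 x := by
    intro x
    rw [hf, Set.inter_indicator_one, Pi.mul_apply]
  simp only [e] at h
  rwa [integral_indicator_one hAm, integral_indicator_one hKm,
    integral_indicator_one (hAm.inter hKm)] at h

/-- A standard Gaussian vector conditioned on a shifted cone has stochastically larger norm than the
projection of a standard Gaussian vector onto the cone. -/
theorem shiftedConeCDF_le_coneCDF (v : Euc d) (z : ℝ) :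
    shiftedConeCDF T v z ≤ coneCDF T z := by
  set μ := stdGaussian (Euc d)
  have hK := (isClosed_shifted_cone T v).measurableSet
  rw [shiftedConeCDF, coneCDF, measureReal_def, cond_apply hK, ENNReal.toReal_mul,
    ENNReal.toReal_inv]
  change (μ.real {x | x + v ∈ T})⁻¹ * μ.real _ ≤ _
  have h := stdGaussian_inter_shifted_cone_le T v z
  have h2 : μ.real ({x | x + v ∈ T} ∩ {x | ‖x‖ ^ 2 ≤ z}) ≤
      μ.real ({x | ‖coneProj T x‖ ^ 2 ≤ z} ∩ {x | x + v ∈ T}) := by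
    refine measureReal_mono fun x hx => ⟨?_, hx.1⟩
    refine le_trans ?_ (show _ ≤ z from hx.2)
    gcongr
    exact norm_coneProj_le T x
  -- On a null shifted cone the conditional measure is zero and the bound is trivial.
  rcases (measureReal_nonneg (μ := μ) (s := {x | x + v ∈ T})).eq_or_lt with h0 | h0
  · rw [← h0, inv_zero, zero_mul]
    exact measureReal_nonneg
  · rw [inv_mul_le_iff₀ h0, mul_comm]
    exact h2.trans h

end Dominance

/-! ### The Gaussian density and thin spherical shells -/

section GaussianDensity

variable {d : ℕ}

/-- The Gaussian kernel `exp (-‖v - x‖² / 2)`. -/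
noncomputable def gaussKernel (v x : Euc d) : ℝ≥0∞ :=
  ENNReal.ofReal (Real.exp (-(1 / 2) * ‖v - x‖ ^ 2))

theorem measurable_gaussKernel (v : Euc d) : Measurable (gaussKernel v) := by
  unfold gaussKernel
  fun_prop

/-- Both sides have the same characteristic function, by the Fourier integral of a Gaussian. Only
the positivity of the constant matters later. -/
theorem stdGaussian_eq_withDensity :
    ∃ c : ℝ, 0 < c ∧ ENNReal.ofReal c • (volume : Measure (Euc d)).withDensity (gaussKernel 0) =
      stdGaussian (Euc d) := by
  set I : ℝ := ∫ x : Euc d, Real.exp (-(1 / 2) * ‖x‖ ^ 2) with hI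
  have hI' := GaussianFourier.integral_rexp_neg_mul_sq_norm (V := Euc d) (b := 1 / 2) (by norm_num)
  have hIpos : 0 < I := by rw [hI, hI']; positivity
  -- The complex power in the Fourier formula is identified with the real integral `I` by taking
  -- that formula without a linear term.
  have hIC : ((Real.pi : ℂ) / (1 / 2 : ℂ)) ^ (Module.finrank ℝ (Euc d) / 2 : ℂ) = (I : ℂ) := by
    rw [← GaussianFourier.integral_cexp_neg_mul_sq_norm (V := Euc d) (b := 1 / 2) (by norm_num),
      hI, ← integral_complex_ofReal]
    refine integral_congr_ae (Eventually.of_forall fun x => ?_)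
    push_cast
    rfl
  -- A non-integrable function would have integral `0`, against `hIpos`.
  have hint : Integrable (fun x : Euc d => Real.exp (-(1 / 2) * ‖x‖ ^ 2)) :=
    not_not.1 fun h => hIpos.ne' (integral_undef h)
  have hk : ∀ x : Euc d, gaussKernel 0 x = ENNReal.ofReal (Real.exp (-(1 / 2) * ‖x‖ ^ 2)) := by
    intro x; rw [gaussKernel, zero_sub, norm_neg]
  have hfin : IsFiniteMeasure ((volume : Measure (Euc d)).withDensity (gaussKernel 0)) := by
    refine isFiniteMeasure_withDensity ?_
    simp only [hk]
    exact hint.lintegral_lt_top.ne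
  refine ⟨I⁻¹, inv_pos.2 hIpos, ?_⟩
  have : IsFiniteMeasure (ENNReal.ofReal I⁻¹ •
      (volume : Measure (Euc d)).withDensity (gaussKernel 0)) :=
    Measure.smul_finite _ ENNReal.ofReal_ne_top
  refine Measure.ext_of_charFun ?_
  ext t
  rw [charFun_stdGaussian, charFun_apply, integral_smul_measure,
    integral_withDensity_eq_integral_toReal_smul (measurable_gaussKernel 0)
      (Eventually.of_forall fun x => ENNReal.ofReal_lt_top)]
  have h := GaussianFourier.integral_cexp_neg_mul_sq_norm_add (V := Euc d) (b := 1 / 2)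
    (by norm_num) Complex.I t
  rw [hIC] at h
  have e : ∀ x : Euc d, (gaussKernel 0 x).toReal • Complex.exp ((inner ℝ x t : ℝ) * Complex.I) =
      Complex.exp (-(1 / 2) * ‖x‖ ^ 2 + Complex.I * (inner ℝ t x : ℝ)) := by
    intro x
    rw [hk, ENNReal.toReal_ofReal (Real.exp_pos _).le, Complex.exp_add, real_inner_comm,
      mul_comm Complex.I, Complex.real_smul]
    push_cast
    rfl
  simp only [e]
  rw [h, ENNReal.toReal_ofReal (inv_pos.2 hIpos).le, Complex.real_smul, ← mul_assoc]
  push_cast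
  rw [inv_mul_cancel₀ (by exact_mod_cast hIpos.ne'), one_mul, Complex.I_sq]
  congr 1
  ring

/-- Positive dimension matters: in dimension zero the sphere of radius `0` is the whole space. -/
theorem stdGaussian_sphere (hd : 1 ≤ d) (r : ℝ) :
    stdGaussian (Euc d) (Metric.sphere 0 r) = 0 := by
  obtain ⟨c, -, hc⟩ := stdGaussian_eq_withDensity (d := d)
  have : Nonempty (Fin d) := ⟨⟨0, hd⟩⟩
  have : Nontrivial (Euc d) := inferInstance
  rw [← hc, Measure.smul_apply,
    withDensity_absolutelyContinuous _ _ (Measure.addHaar_sphere volume (0 : Euc d) r), smul_zero]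

/-- A probability measure on `[0, ∞)` without atoms gives uniformly small mass to short intervals. -/
theorem exists_measureReal_Ioc_le (ν : Measure ℝ) [IsProbabilityMeasure ν]
    (hatom : ∀ x, ν {x} = 0) (hneg : ν (Set.Iio 0) = 0) {η : ℝ} (hη : 0 < η) :
    ∃ δ > 0, ∀ z, ν.real (Set.Ioc z (z + δ)) ≤ η := by
  set F := cdf ν with hF
  have hcont : Continuous F := by
    refine continuous_iff_continuousAt.2 fun x => ?_
    rw [continuousAt_iff_continuous_left'_right']
    refine ⟨?_, (F.right_continuous x).mono Set.Ioi_subset_Ici_self⟩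
    rw [F.mono.continuousWithinAt_Iio_iff_leftLim_eq]
    have h := F.measure_singleton x
    rw [hF, measure_cdf, hatom, eq_comm, ENNReal.ofReal_eq_zero] at h
    exact le_antisymm (F.mono.leftLim_le le_rfl) (by linarith)
  have hFneg : ∀ z, z ≤ 0 → F z = 0 := by
    intro z hz
    rw [hF, cdf_eq_real, measureReal_def]
    have : ν (Set.Iic z) = 0 := by
      refine measure_mono_null (fun x hx => ?_) (measure_union_null hneg (hatom 0))
      rcases (le_trans hx hz).lt_or_eq with h | h
      · exact Or.inl h
      · exact Or.inr h
    rw [this]; rfl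
  -- Composed with the absolute value, the distribution function has the same limit at both ends,
  -- hence is uniformly continuous. Since it vanishes on `(-∞, 0]`, nothing is lost in replacing `z`
  -- by `max z 0`.
  have huc : UniformContinuous fun z => F |z| := by
    refine (hcont.comp continuous_abs).uniformContinuous_of_tendsto_cocompact (x := 1) ?_
    exact (tendsto_cdf_atTop ν).comp (tendsto_norm_cocompact_atTop (E := ℝ))
  obtain ⟨δ, hδ, h⟩ := Metric.uniformContinuous_iff.1 huc η hη
  refine ⟨δ / 2, by positivity, fun z => ?_⟩
  have e : ν.real (Set.Ioc z (z + δ / 2)) = F (z + δ / 2) - F z := by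
    rw [measureReal_def]
    conv_lhs => rw [← measure_cdf ν]
    rw [StieltjesFunction.measure_Ioc, ENNReal.toReal_ofReal]
    exact sub_nonneg.2 (F.mono (by linarith))
  have hmax : ∀ z, F z = F |max z 0| := by
    intro z
    rcases le_total z 0 with h | h
    · rw [max_eq_right h, abs_zero, hFneg z h, hFneg 0 le_rfl]
    · rw [max_eq_left h, abs_of_nonneg h]
  rw [e, hmax z, hmax (z + δ / 2)]
  have h1 := h (a := max (z + δ / 2) 0) (b := max z 0) (by
    rw [Real.dist_eq]
    refine (abs_max_sub_max_le_abs _ _ _).trans_lt ?_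
    rw [add_sub_cancel_left, abs_of_pos (by positivity)]
    linarith)
  rw [Real.dist_eq] at h1
  exact (le_abs_self _).trans h1.le

/-- An error in the radius of a ball costs little probability, uniformly in the radius; this allows
a supremum over all `z`. -/
theorem exists_stdGaussian_shell_le (hd : 1 ≤ d) {η : ℝ} (hη : 0 < η) :
    ∃ δ > 0, ∀ z, (stdGaussian (Euc d)).real {x | z < ‖x‖ ^ 2 ∧ ‖x‖ ^ 2 ≤ z + δ} ≤ η := by
  have hm : Measurable fun x : Euc d => ‖x‖ ^ 2 := by fun_prop
  have : IsProbabilityMeasure ((stdGaussian (Euc d)).map fun x => ‖x‖ ^ 2) :=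
    Measure.isProbabilityMeasure_map hm.aemeasurable
  have hatom : ∀ r, ((stdGaussian (Euc d)).map fun x => ‖x‖ ^ 2) {r} = 0 := by
    intro r
    rw [Measure.map_apply hm (measurableSet_singleton r)]
    refine measure_mono_null (fun x hx => ?_) (stdGaussian_sphere hd (Real.sqrt r))
    rw [mem_sphere_zero_iff_norm]
    rw [← (show _ = r from hx), Real.sqrt_sq (norm_nonneg _)]
  have hneg : ((stdGaussian (Euc d)).map fun x => ‖x‖ ^ 2) (Set.Iio 0) = 0 := by
    rw [Measure.map_apply hm measurableSet_Iio]
    convert measure_empty (μ := stdGaussian (Euc d))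
    ext x
    simp
  obtain ⟨δ, hδ, h⟩ := exists_measureReal_Ioc_le _ hatom hneg hη
  refine ⟨δ, hδ, fun z => ?_⟩
  have := h z
  rwa [map_measureReal_apply hm measurableSet_Ioc] at this

/-- The Gaussian measure centred at `v` has density proportional to the Gaussian kernel. -/
theorem exists_map_add_stdGaussian_apply :
    ∃ c : ℝ, 0 < c ∧ ∀ (v : Euc d) (s : Set (Euc d)),
      (stdGaussian (Euc d)).map (· + v) s = ENNReal.ofReal c * ∫⁻ x in s, gaussKernel v x := by
  obtain ⟨c, hc, h⟩ := stdGaussian_eq_withDensity (d := d)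
  refine ⟨c, hc, fun v s => ?_⟩
  have e : (stdGaussian (Euc d)).map (· + v) =
      ENNReal.ofReal c • volume.withDensity (gaussKernel v) := by
    have hmp := measurePreserving_add_right (volume : Measure (Euc d)) v
    rw [← h, Measure.map_smul]
    congr 1
    ext t ht
    rw [Measure.map_apply (by fun_prop) ht, withDensity_apply _ (hmp.measurable ht),
      withDensity_apply _ ht, ← hmp.setLIntegral_comp_preimage ht (measurable_gaussKernel v)]
    refine lintegral_congr fun x => ?_
    simp only [gaussKernel, zero_sub, norm_neg, sub_add_cancel_right]
  rw [e, Measure.smul_apply, withDensity_apply', smul_eq_mul]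

end GaussianDensity

/-! ### Gaussian integrals over sets covering a cone -/

section Covering

variable {d : ℕ}

theorem tendsto_measure_compl_closedBall (m : Measure (Euc d)) [IsFiniteMeasure m] {r : ℕ → ℝ}
    (hr : Tendsto r atTop atTop) :
    Tendsto (fun n => m (Metric.closedBall 0 (r n))ᶜ) atTop (𝓝 0) := by
  have h := tendsto_measure_iInter_atTop (μ := m) (s := fun R : ℝ => (Metric.closedBall (0 : Euc d) R)ᶜ)
    (fun R => Metric.isClosed_closedBall.measurableSet.compl.nullMeasurableSet)
    (fun R S h => Set.compl_subset_compl.2 (Metric.closedBall_subset_closedBall h))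
    ⟨0, measure_ne_top _ _⟩
  have e : ⋂ R : ℝ, (Metric.closedBall (0 : Euc d) R)ᶜ = ∅ := by
    refine Set.eq_empty_of_forall_notMem fun x hx => ?_
    exact Set.mem_iInter.1 hx ‖x‖ (by simp)
  rw [e, measure_empty] at h
  exact h.comp hr

/-- The truncated sets increase to a convex set dense in `T`, and a convex set differs from its
closure by a Lebesgue null set. What lies outside the growing balls is negligible for a finite
measure. -/
theorem Covers.tendsto_measure_diff {A : ℕ → Set (Euc d)} {T : Set (Euc d)} (hA : Covers A T)
    (m : Measure (Euc d)) [IsFiniteMeasure m] (hm : m ≪ volume) {r : ℕ → ℝ}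
    (hr : Tendsto r atTop atTop) :
    Tendsto (fun n => m (A n \ T) + m (T \ (A n ∩ Metric.closedBall 0 (r n)))) atTop (𝓝 0) := by
  obtain ⟨-, k, N, hk, hconv, hmono, hT⟩ := hA
  set B : ℕ → Set (Euc d) := fun n => A n ∩ Metric.closedBall 0 (k n) with hB
  have hTc : IsClosed T := hT ▸ isClosed_closure
  have hBT : ∀ n, N ≤ n → B n ⊆ T := fun n hn => by
    rw [hT]
    exact (Set.subset_biUnion_of_mem (u := B) (Set.mem_Ici.2 hn)).trans subset_closure
  have h1 : Tendsto (fun n => m (A n \ T)) atTop (𝓝 0) := by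
    refine tendsto_of_tendsto_of_tendsto_of_le_of_le' tendsto_const_nhds
      (tendsto_measure_compl_closedBall m hk) (Eventually.of_forall fun _ => zero_le) ?_
    filter_upwards [eventually_ge_atTop N] with n hn
    exact measure_mono fun x hx hxb => hx.2 (hBT n hn ⟨hx.1, hxb⟩)
  have hBm : Monotone fun n => B (n + N) := fun a b hab => hmono _ _ (by omega) (by omega)
  have hBc : ∀ n, Convex ℝ (B (n + N)) := fun n => hconv _ (by omega)
  have hU : ⋃ n ∈ Set.Ici N, B n = ⋃ n, B (n + N) := by
    ext x
    simp only [Set.mem_iUnion, Set.mem_Ici, exists_prop]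
    constructor
    · rintro ⟨n, hn, hx⟩
      exact ⟨n - N, by rwa [Nat.sub_add_cancel hn]⟩
    · rintro ⟨n, hx⟩
      exact ⟨n + N, by omega, hx⟩
  have hUc : Convex ℝ (⋃ n, B (n + N)) := hBm.directed_le.convex_iUnion hBc
  have h2' : Tendsto (fun n => m (T \ B (n + N))) atTop (𝓝 0) := by
    have h := tendsto_measure_iInter_atTop (μ := m) (s := fun n => T \ B (n + N))
      (fun n => (hTc.measurableSet.nullMeasurableSet).diff
        (((hBc n).nullMeasurableSet volume).mono_ac hm))
      (fun a b hab => Set.sdiff_subset_sdiff_right (hBm hab)) ⟨0, measure_ne_top _ _⟩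
    -- The closure of the convex union minus the union is contained in its frontier, which is null.
    have e : m (⋂ n, T \ B (n + N)) = 0 := by
      refine hm (measure_mono_null ?_ (hUc.addHaar_frontier volume))
      rw [← Set.sdiff_iUnion, hT, hU]
      exact Set.sdiff_subset_sdiff_right interior_subset
    rwa [e] at h
  have h2 : Tendsto (fun n => m (T \ B n)) atTop (𝓝 0) := (tendsto_add_atTop_iff_nat N).1 h2'
  have h3 : Tendsto (fun n => m (T \ (A n ∩ Metric.closedBall 0 (r n)))) atTop (𝓝 0) := by
    have h4 := h2.add (tendsto_measure_compl_closedBall m hr)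
    rw [add_zero] at h4
    refine tendsto_of_tendsto_of_tendsto_of_le_of_le tendsto_const_nhds h4
      (fun _ => zero_le) fun n => ?_
    refine (measure_mono ?_).trans (measure_union_le _ _)
    intro x hx
    by_cases hxr : x ∈ Metric.closedBall 0 (r n)
    · exact Or.inl ⟨hx.1, fun h => hx.2 ⟨h.1, hxr⟩⟩
    · exact Or.inr hxr
  simpa using h1.add h3

/-- Since `‖x‖² ≤ 2 ‖v - x‖² + 2 ‖v‖²`, all these densities are at most a multiple of `exp (-‖x‖² /
4)`. One finite measure for all bounded shifts makes the covering limit uniform in `v`. -/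
theorem exists_dominating_measure (M : ℝ) :
    ∃ m : Measure (Euc d), IsFiniteMeasure m ∧ m ≪ volume ∧
      ∀ v : Euc d, ‖v‖ ≤ M → (stdGaussian (Euc d)).map (· + v) ≤ m := by
  obtain ⟨c, hc, h⟩ := exists_map_add_stdGaussian_apply (d := d)
  have hint : Integrable (fun x : Euc d => Real.exp (-(1 / 4) * ‖x‖ ^ 2)) := by
    by_contra hn
    have hI := GaussianFourier.integral_rexp_neg_mul_sq_norm (V := Euc d) (b := 1 / 4) (by norm_num)
    rw [integral_undef hn] at hI
    have : 0 < (Real.pi / (1 / 4)) ^ (Module.finrank ℝ (Euc d) / 2 : ℝ) := by positivity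
    exact this.ne hI
  refine ⟨ENNReal.ofReal (c * Real.exp (M ^ 2 / 2)) • volume.withDensity fun x =>
    ENNReal.ofReal (Real.exp (-(1 / 4) * ‖x‖ ^ 2)), ?_, ?_, fun v hv => ?_⟩
  · have := isFiniteMeasure_withDensity_ofReal (μ := (volume : Measure (Euc d))) hint.2
    exact Measure.smul_finite _ ENNReal.ofReal_ne_top
  · exact (withDensity_absolutelyContinuous _ _).smul_left _
  · refine Measure.le_intro fun s hs _ => ?_
    rw [h v s, Measure.smul_apply, withDensity_apply _ hs, smul_eq_mul,
      ENNReal.ofReal_mul hc.le, mul_assoc]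
    gcongr
    rw [← lintegral_const_mul _ (by fun_prop)]
    refine lintegral_mono fun x => ?_
    rw [gaussKernel, ← ENNReal.ofReal_mul (Real.exp_pos _).le, ← Real.exp_add]
    refine ENNReal.ofReal_le_ofReal (Real.exp_le_exp.2 ?_)
    have h1 : ‖x‖ ^ 2 ≤ 2 * ‖v - x‖ ^ 2 + 2 * ‖v‖ ^ 2 := by
      have : ‖x‖ ≤ ‖v - x‖ + ‖v‖ := by
        rw [norm_sub_rev]
        simpa using norm_add_le (x - v) v
      nlinarith [norm_nonneg x, sq_nonneg (‖v - x‖ - ‖v‖)]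
    have h2 : ‖v‖ ^ 2 ≤ M ^ 2 := by gcongr
    linarith

/-- Uniformly over bounded shifts `v` in the cone, Gaussian probabilities of balls centred at `v`,
relative to sets covering the cone, are at most those relative to the cone, up to `ε`. -/
theorem Covers.exists_map_add_stdGaussian_le (hd : 1 ≤ d) {T : ProperCone ℝ (Euc d)}
    (hT : 0 < volume (T : Set (Euc d))) {A : ℕ → Set (Euc d)} (hA : Covers A (T : Set (Euc d)))
    {r : ℕ → ℝ} (hr : Tendsto r atTop atTop) (M : ℝ) {ε : ℝ} (hε : 0 < ε) :
    ∃ δ > 0, ∀ᶠ n in atTop, ∀ v ∈ T, ‖v‖ ≤ M → ∀ z : ℝ,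
      (stdGaussian (Euc d)).map (· + v) (A n ∩ {x | ‖v - x‖ ^ 2 ≤ z + δ}) ≤
        ENNReal.ofReal (shiftedConeCDF T v z + ε) *
          (stdGaussian (Euc d)).map (· + v) (A n ∩ Metric.closedBall 0 (r n)) := by
  set μ := stdGaussian (Euc d) with hμ
  obtain ⟨c, hc, hcv⟩ := exists_map_add_stdGaussian_apply (d := d)
  -- For `v ∈ T` one has `T ⊆ T - v`, so `τ` bounds the conditioning probabilities from below
  -- uniformly.
  set τ := μ.real (T : Set (Euc d)) with hτ
  have hTm : MeasurableSet (T : Set (Euc d)) := T.isClosed.measurableSet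
  have hτpos : 0 < τ := by
    refine ENNReal.toReal_pos (ne_of_gt ?_) (measure_ne_top _ _)
    have h := hcv 0 (T : Set (Euc d))
    simp only [add_zero, Measure.map_id'] at h
    rw [← hμ] at h
    rw [h]
    refine (ENNReal.mul_pos (ENNReal.ofReal_pos.2 hc).ne' ?_)
    rw [← withDensity_apply _ hTm]
    intro h0
    rw [withDensity_apply_eq_zero (measurable_gaussKernel 0)] at h0
    have hsub : (T : Set (Euc d)) ⊆ {x | gaussKernel 0 x ≠ 0} ∩ T := fun x hx =>
      ⟨(ENNReal.ofReal_pos.2 (Real.exp_pos _)).ne', hx⟩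
    exact hT.ne' (measure_mono_null hsub h0)
  obtain ⟨m, hmf, hmv, hm⟩ := exists_dominating_measure (d := d) M
  obtain ⟨δ, hδ, hshell⟩ := exists_stdGaussian_shell_le (d := d) hd (η := ε * τ / 2) (by positivity)
  refine ⟨δ, hδ, ?_⟩
  have hlim := hA.tendsto_measure_diff m hmv hr
  -- The error budget is `ε τ`: the shell takes half, and the two set differences take `κ * (2 +
  -- ε)`, which is the other half.
  have hκ : 0 < ε * τ / (2 * (2 + ε)) := by positivity
  filter_upwards [hlim.eventually (ge_mem_nhds (ENNReal.ofReal_pos.2 hκ))] with n hn v hv hvM z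
  set ν := μ.map (· + v) with hν
  have hνp : IsProbabilityMeasure ν := Measure.isProbabilityMeasure_map (by fun_prop)
  have hνr : ∀ s, MeasurableSet s → ν.real s = μ.real ((· + v) ⁻¹' s) := fun s hs =>
    map_measureReal_apply (by fun_prop) hs
  set κ := ε * τ / (2 * (2 + ε)) with hκdef
  have hd1 : ν.real (A n \ T) ≤ κ := by
    refine ENNReal.toReal_le_of_le_ofReal hκ.le ?_
    exact (hm v hvM _).trans (le_self_add.trans hn)
  have hd2 : ν.real ((T : Set (Euc d)) \ (A n ∩ Metric.closedBall 0 (r n))) ≤ κ := by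
    refine ENNReal.toReal_le_of_le_ofReal hκ.le ?_
    exact (hm v hvM _).trans (le_add_self.trans hn)
  set t := ν.real (T : Set (Euc d)) with ht
  set s := shiftedConeCDF T v z with hs
  set b := ν.real (A n ∩ Metric.closedBall 0 (r n)) with hb
  have hbt : t ≤ b + κ := by
    refine le_trans ?_ (add_le_add_right hd2 b)
    refine (measureReal_mono ?_).trans (measureReal_union_le _ _)
    intro x hx
    by_cases h : x ∈ A n ∩ Metric.closedBall 0 (r n)
    · exact Or.inl h
    · exact Or.inr ⟨hx, h⟩
  have htK : t = μ.real {x | x + v ∈ T} := hνr _ hTm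
  have htτ : τ ≤ t := by
    rw [htK]
    exact measureReal_mono fun x hx => T.add_mem hx hv
  have ht1 : t ≤ 1 := measureReal_le_one
  have hs0 : 0 ≤ s := measureReal_nonneg
  have hball : ∀ w : ℝ, MeasurableSet {x : Euc d | ‖v - x‖ ^ 2 ≤ w} := fun w =>
    (isClosed_le (by fun_prop) continuous_const).measurableSet
  have hst : ν.real ((T : Set (Euc d)) ∩ {x | ‖v - x‖ ^ 2 ≤ z}) = s * t := by
    have h1 : s = t⁻¹ * μ.real ({x | x + v ∈ T} ∩ {x | ‖x‖ ^ 2 ≤ z}) := by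
      rw [hs, htK, shiftedConeCDF, measureReal_def,
        cond_apply (isClosed_shifted_cone T v).measurableSet, ENNReal.toReal_mul,
        ENNReal.toReal_inv]
      rfl
    rw [hνr _ (hTm.inter (hball z)), h1, mul_comm, ← mul_assoc,
      mul_inv_cancel₀ (hτpos.trans_le htτ).ne', one_mul]
    congr 1
    ext x
    simp
  have hs1 : s ≤ 1 := by
    have : s * t ≤ t := hst ▸ measureReal_mono Set.inter_subset_left
    nlinarith
  have hsh : ν.real {x | z < ‖v - x‖ ^ 2 ∧ ‖v - x‖ ^ 2 ≤ z + δ} ≤ ε * τ / 2 := by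
    rw [hνr]
    · refine le_trans (le_of_eq ?_) (hshell z)
      congr 1
      ext x
      simp
    · exact ((isOpen_lt (f := fun _ : Euc d => z) (g := fun x => ‖v - x‖ ^ 2) continuous_const
        (by fun_prop)).measurableSet).inter (hball _)
  have ha : ν.real (A n ∩ {x | ‖v - x‖ ^ 2 ≤ z + δ}) ≤ κ + (s * t + ε * τ / 2) := by
    rw [← hst]
    refine le_trans ?_ (add_le_add hd1 (add_le_add_right hsh _))
    refine le_trans ?_ (add_le_add_right (measureReal_union_le _ _) _)
    refine (measureReal_mono ?_).trans (measureReal_union_le _ _)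
    intro x hx
    by_cases hxT : x ∈ (T : Set (Euc d))
    · refine Or.inr ?_
      by_cases hxz : ‖v - x‖ ^ 2 ≤ z
      · exact Or.inl ⟨hxT, hxz⟩
      · exact Or.inr ⟨not_le.1 hxz, hx.2⟩
    · exact Or.inl ⟨hx.1, hxT⟩
  have hfin : ν.real (A n ∩ {x | ‖v - x‖ ^ 2 ≤ z + δ}) ≤ (s + ε) * b := by
    have h1 : κ * (2 + ε) = ε * τ / 2 := by
      rw [hκdef]
      field_simp
    nlinarith [mul_le_mul_of_nonneg_left hbt (by positivity : 0 ≤ s + ε),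
      mul_le_mul_of_nonneg_left htτ hε.le, mul_le_mul_of_nonneg_right hs1 hκ.le]
  rw [← ofReal_measureReal (μ := ν), ← ofReal_measureReal (μ := ν),
    ← ENNReal.ofReal_mul (by positivity)]
  exact ENNReal.ofReal_le_ofReal hfin

end Covering

/-! ### Change of variables to the local reduced form -/

section ChangeOfVariables

variable {Θ X : Type*} [MeasurableSpace Θ] [MeasurableSpace X] {prior : Measure Θ} {ν : Measure X}
  {ψ : Θ → X} {S N : Set Θ} {D : Set X} {h : X → ℝ≥0∞}

/-- An upper bound may enlarge `S` to the preimage of a measurable hull of its image, so neither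
injectivity nor saturation enters. -/
theorem setLIntegral_comp_le_of_map_restrict_le [SFinite ν] (hψ : Measurable ψ)
    (hSN : S ⊆ N) (hD : MeasurableSet D) (hSD : ψ '' S ⊆ D) {c : ℝ≥0∞}
    (hle : ((prior.restrict N).map ψ).restrict D ≤ c • ν.restrict D) (hh : Measurable h) :
    ∫⁻ θ in S, h (ψ θ) ∂prior ≤ c * ∫⁻ x in ψ '' S, h x ∂ν := by
  set E := toMeasurable ν (ψ '' S) ∩ D with hE
  have hEm : MeasurableSet E := (measurableSet_toMeasurable _ _).inter hD
  calc ∫⁻ θ in S, h (ψ θ) ∂prior ≤ ∫⁻ θ in ψ ⁻¹' E ∩ N, h (ψ θ) ∂prior := by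
        refine lintegral_mono_set fun θ hθ => ⟨⟨?_, ?_⟩, hSN hθ⟩
        · exact subset_toMeasurable _ _ (Set.mem_image_of_mem ψ hθ)
        · exact hSD (Set.mem_image_of_mem ψ hθ)
    _ = ∫⁻ x in E, h x ∂((prior.restrict N).map ψ) := by
        rw [setLIntegral_map hEm hh hψ, Measure.restrict_restrict (hψ hEm)]
    _ = ∫⁻ x in E, h x ∂(((prior.restrict N).map ψ).restrict D) := by
        rw [Measure.restrict_restrict hEm, Set.inter_eq_left.2 Set.inter_subset_right]
    _ ≤ ∫⁻ x in E, h x ∂(c • ν.restrict D) := lintegral_mono' (Measure.restrict_mono_measure hle E) le_rfl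
    _ = c * ∫⁻ x in E, h x ∂(ν.restrict D) := by
        rw [Measure.restrict_smul, lintegral_smul_measure, smul_eq_mul]
    _ ≤ c * ∫⁻ x in toMeasurable ν (ψ '' S), h x ∂ν := by
        refine mul_le_mul_right ?_ c
        rw [Measure.restrict_restrict hEm]
        exact lintegral_mono_set (Set.inter_subset_left.trans Set.inter_subset_left)
    _ = _ := by rw [Measure.restrict_toMeasurable_of_sFinite]

/-- For the lower bound the preimage of the image must fall back into `S`. The condition `hsat`
guarantees this almost everywhere over `G`, starting from a measurable kernel of the image. -/
theorem le_setLIntegral_comp_of_le_map_restrict (hψ : Measurable ψ)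
    (hSD : ψ '' S ⊆ D) {c : ℝ≥0∞}
    (hle : c • ν.restrict D ≤ ((prior.restrict N).map ψ).restrict D) (hh : Measurable h)
    (hI : NullMeasurableSet (ψ '' S) ν) {G : Set X} (hG : MeasurableSet G)
    (hsat : prior {θ | θ ∈ N ∧ ψ θ ∈ G ∧ ψ θ ∈ ψ '' S ∧ θ ∉ S} = 0) :
    c * ∫⁻ x in ψ '' S ∩ G, h x ∂ν ≤ ∫⁻ θ in S, h (ψ θ) ∂prior := by
  obtain ⟨E, hEsub, hEm, hEae⟩ := hI.exists_measurable_subset_ae_eq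
  have hEGm := hEm.inter hG
  have hEGD : E ∩ G ⊆ D := fun x hx => hSD (hEsub hx.1)
  calc c * ∫⁻ x in ψ '' S ∩ G, h x ∂ν = c * ∫⁻ x in E ∩ G, h x ∂ν := by
        rw [Measure.restrict_congr_set (hEae.symm.inter (ae_eq_refl G))]
    _ = ∫⁻ x in E ∩ G, h x ∂(c • ν.restrict D) := by
        rw [Measure.restrict_smul, lintegral_smul_measure, Measure.restrict_restrict hEGm,
          Set.inter_eq_left.2 hEGD, smul_eq_mul]
    _ ≤ ∫⁻ x in E ∩ G, h x ∂(((prior.restrict N).map ψ).restrict D) :=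
        lintegral_mono' (Measure.restrict_mono_measure hle _) le_rfl
    _ = ∫⁻ θ in ψ ⁻¹' (E ∩ G) ∩ N, h (ψ θ) ∂prior := by
        rw [Measure.restrict_restrict hEGm, Set.inter_eq_left.2 hEGD, setLIntegral_map hEGm hh hψ,
          Measure.restrict_restrict (hψ hEGm)]
    _ ≤ ∫⁻ θ in S, h (ψ θ) ∂prior := by
        refine lintegral_mono_set' ?_
        have h0 : ∀ᵐ θ ∂prior, ¬ (θ ∈ N ∧ ψ θ ∈ G ∧ ψ θ ∈ ψ '' S ∧ θ ∉ S) := by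
          rw [ae_iff]
          simpa only [not_not] using hsat
        filter_upwards [h0] with θ hθ hmem
        by_contra hS
        exact hθ ⟨hmem.2, hmem.1.2, hEsub hmem.1.1, hS⟩

end ChangeOfVariables

/-! ### Local flatness of the prior, scaling and factorization of integrals. -/

section LocalPrior

variable {Ω Θ : Type*} [MeasurableSpace Ω] [MeasurableSpace Θ] {d k : ℕ}

/-- Near the origin the image of the prior is, up to a factor `1 + η`, a multiple of Lebesgue
measure. -/
theorem PriorSingular.exists_bounds {P : Measure Ω} {prior : Measure Θ} {L : ℕ → Ω → Θ → EReal}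
    {ΘN : Set Θ} {γ : Θ → Euc d} {γp : Θ → Euc k} {Γ : Set (Euc d)} {Γp : Set (Euc k)}
    (hprior : PriorSingular P prior L ΘN γ γp Γ Γp) (hΓ : MeasurableSet Γ)
    (hΓp : MeasurableSet Γp) (h0 : (0 : Euc d) ∈ Γ) (h0p : (0 : Euc k) ∈ Γp) {η : ℝ} (hη : 0 < η) :
    ∃ ρ > 0, ∃ p₀ : ℝ, 0 < p₀ ∧
      ENNReal.ofReal p₀ • volume.restrict (Metric.ball 0 ρ ∩ Γ ×ˢ Γp) ≤
        ((prior.restrict ΘN).map (fun θ => (γ θ, γp θ))).restrict (Metric.ball 0 ρ ∩ Γ ×ˢ Γp) ∧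
      ((prior.restrict ΘN).map (fun θ => (γ θ, γp θ))).restrict (Metric.ball 0 ρ ∩ Γ ×ˢ Γp) ≤
        ENNReal.ofReal ((1 + η) * p₀) • volume.restrict (Metric.ball 0 ρ ∩ Γ ×ˢ Γp) := by
  obtain ⟨δ, hδ, p, hpc, hpos, hp⟩ := hprior.density
  set ν := (prior.restrict ΘN).map (fun θ => (γ θ, γp θ))
  set D := Metric.ball (0 : Euc d × Euc k) δ ∩ Γ ×ˢ Γp with hD
  have h0D : (0 : Euc d × Euc k) ∈ D := ⟨Metric.mem_ball_self hδ, h0, h0p⟩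
  have hp0 := hpos 0 h0D
  -- With this oscillation the density lies between `2 / (2 + η) * p 0` and `(2 + 2 η) / (2 + η) * p
  -- 0`, whose ratio is exactly `1 + η`.
  have hη' : 0 < η / (2 + η) * p 0 := by positivity
  obtain ⟨ρ, hρ, hρp⟩ := Metric.continuousWithinAt_iff.1 (hpc 0 h0D) _ hη'
  set D' := Metric.ball (0 : Euc d × Euc k) (min ρ δ) ∩ Γ ×ˢ Γp with hD'
  have hD'm : MeasurableSet D' := Metric.isOpen_ball.measurableSet.inter (hΓ.prod hΓp)
  have hDm : MeasurableSet D := Metric.isOpen_ball.measurableSet.inter (hΓ.prod hΓp)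
  have hsub : D' ⊆ D := Set.inter_subset_inter_left _ (Metric.ball_subset_ball (min_le_right _ _))
  have hbd : ∀ x ∈ D', 2 / (2 + η) * p 0 ≤ p x ∧ p x ≤ (1 + η) * (2 / (2 + η) * p 0) := by
    intro x hx
    have h := hρp (hsub hx) ((Metric.mem_ball.1 hx.1).trans_le (min_le_left _ _))
    rw [Real.dist_eq, abs_lt] at h
    have e1 : 2 / (2 + η) * p 0 = p 0 - η / (2 + η) * p 0 := by field_simp; ring
    have e2 : (1 + η) * (2 / (2 + η) * p 0) = p 0 + η / (2 + η) * p 0 := by field_simp; ring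
    rw [e1] at *
    rw [e2]
    constructor <;> linarith [h.1, h.2]
  have hν : ν.restrict D' = (volume.restrict D').withDensity fun x => ENNReal.ofReal (p x) := by
    have : (ν.restrict D).restrict D' = ν.restrict D' := by
      rw [Measure.restrict_restrict hD'm, Set.inter_eq_left.2 hsub]
    rw [← this, hp, restrict_withDensity hD'm, Measure.restrict_restrict hD'm,
      Set.inter_eq_left.2 hsub]
  refine ⟨min ρ δ, lt_min hρ hδ, 2 / (2 + η) * p 0, by positivity, ?_, ?_⟩
  · rw [hν, ← withDensity_const]
    refine withDensity_mono ?_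
    filter_upwards [ae_restrict_mem hD'm] with x hx
    exact ENNReal.ofReal_le_ofReal (hbd x hx).1
  · rw [hν, ← withDensity_const]
    refine withDensity_mono ?_
    filter_upwards [ae_restrict_mem hD'm] with x hx
    exact ENNReal.ofReal_le_ofReal (hbd x hx).2

theorem setLIntegral_comp_smul {c : ℝ} (hc : 0 < c) (A : Set (Euc d)) (h : Euc d → ℝ≥0∞) :
    ∫⁻ a in A, h (c • a) = ENNReal.ofReal |(c ^ d)⁻¹| * ∫⁻ x in (fun a => c • a) '' A, h x := by
  have hme : MeasurableEmbedding fun a : Euc d => c • a :=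
    (Homeomorph.smulOfNeZero c hc.ne').measurableEmbedding
  have hmap := Measure.map_addHaar_smul (volume : Measure (Euc d)) hc.ne'
  rw [finrank_euclideanSpace_fin] at hmap
  have h1 := hme.lintegral_map h (μ := volume.restrict A)
  have h2 := hme.restrict_map volume ((fun a => c • a) '' A)
  rw [hme.injective.preimage_image] at h2
  rw [← h1, ← h2, hmap, Measure.restrict_smul, lintegral_smul_measure, smul_eq_mul]

theorem setLIntegral_prod_mul {A : Set (Euc d)} {C : Set (Euc k)} {h₁ : Euc d → ℝ≥0∞}
    {h₂ : Euc k → ℝ≥0∞} (hh₁ : Measurable h₁) (hh₂ : Measurable h₂) :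
    ∫⁻ x in A ×ˢ C, h₁ x.1 * h₂ x.2 = (∫⁻ a in A, h₁ a) * ∫⁻ c in C, h₂ c := by
  rw [Measure.volume_eq_prod, ← Measure.prod_restrict,
    lintegral_prod_mul hh₁.aemeasurable hh₂.aemeasurable]

end LocalPrior

/-! ### Prior integrals over the local neighborhoods -/

section LocalIntegrals

variable {Ω Θ : Type*} [MeasurableSpace Ω] [TopologicalSpace Θ] [MeasurableSpace Θ] {d k : ℕ}
  {P : Measure Ω} {prior : Measure Θ} {L : ℕ → Ω → Θ → EReal} {ΘI ΘN : Set Θ} {Θos : ℕ → Set Θ}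
  {γ : Θ → Euc d} {γp : Θ → Euc k} {Γ : Set (Euc d)} {Γp : Set (Euc k)} {T : ProperCone ℝ (Euc d)}

theorem LocalReparam.eq_zero (hrep : LocalReparam prior ΘI ΘN Θos γ γp Γ Γp T) {θ : Θ}
    (hθ : θ ∈ ΘI) : γ θ = 0 ∧ γp θ = 0 :=
  (hrep.eq_zero_iff θ (subset_of_mem_nhdsSet hrep.nhds_N hθ)).2 hθ

theorem LocalReparam.subset_os (hrep : LocalReparam prior ΘI ΘN Θos γ γp Γ Γp T) (n : ℕ) :
    ΘI ⊆ Θos n :=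
  subset_of_mem_nhdsSet (hrep.nhds_os n)

theorem LocalReparam.zero_mem (hrep : LocalReparam prior ΘI ΘN Θos γ γp Γ Γp T)
    (hI : ΘI.Nonempty) : (0 : Euc d) ∈ Γ ∧ (0 : Euc k) ∈ Γp := by
  obtain ⟨θ, hθ⟩ := hI
  have h := hrep.mapsTo θ (subset_of_mem_nhdsSet hrep.nhds_N hθ)
  rwa [(hrep.eq_zero hθ).1, (hrep.eq_zero hθ).2] at h

/-- Under the prior, with a Gaussian factor in the regular directions and any factor in the singular
directions, local balls carry asymptotically at most their mass under the Gaussian measure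
conditioned on the cone. -/
theorem LocalReparam.exists_setLIntegral_le (hrep : LocalReparam prior ΘI ΘN Θos γ γp Γ Γp T)
    (hprior : PriorSingular P prior L ΘN γ γp Γ Γp) (hd : 1 ≤ d)
    (hT : 0 < volume (T : Set (Euc d))) (hI : ΘI.Nonempty)
    (hshrink : ∀ ε : ℝ, 0 < ε → ∀ᶠ n in atTop, ∀ θ ∈ Θos n, ‖(γ θ, γp θ)‖ ≤ ε)
    (hprod : ∀ᶠ n in atTop,
      (fun θ => (γ θ, γp θ)) '' Θos n = (γ '' Θos n) ×ˢ (γp '' Θos n))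
    (M : ℝ) {ε : ℝ} (hε : 0 < ε) :
    ∃ δ > 0, ∀ᶠ n : ℕ in atTop, ∀ v ∈ T, ‖v‖ ≤ M → ∀ h : Euc k → ℝ≥0∞, Measurable h → ∀ z : ℝ,
      ∫⁻ θ in Θos n ∩ {θ | ‖v - Real.sqrt n • γ θ‖ ^ 2 ≤ z + δ},
          gaussKernel v (Real.sqrt n • γ θ) * h (γp θ) ∂prior ≤
        ENNReal.ofReal ((1 + ε) * (shiftedConeCDF T v z + ε)) *
          ∫⁻ θ in Θos n, gaussKernel v (Real.sqrt n • γ θ) * h (γp θ) ∂prior := by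
  obtain ⟨h0, h0p⟩ := hrep.zero_mem hI
  obtain ⟨ρ, hρ, p₀, hp₀, hlo, hhi⟩ := hprior.exists_bounds hrep.measurableSet_Γ
    hrep.measurableSet_Γp h0 h0p hε
  obtain ⟨r, hr, hsat⟩ := hrep.saturated
  obtain ⟨δ, hδ, hcov⟩ := hrep.covers.exists_map_add_stdGaussian_le hd hT hr M hε
  obtain ⟨c, hc, hcv⟩ := exists_map_add_stdGaussian_apply (d := d)
  refine ⟨δ, hδ, ?_⟩
  filter_upwards [hsat, hcov, hshrink (ρ / 2) (by positivity), hprod, hrep.os_subset,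
    hrep.nullMeasurable, eventually_ge_atTop 1] with n hsat hcov hshrink hprod hsub hnull hn v hv
    hvM h hh z
  have hψ : Measurable fun θ => (γ θ, γp θ) := hrep.measurable_γ.prodMk hrep.measurable_γp
  have hsqrt : 0 < Real.sqrt n := Real.sqrt_pos.2 (by exact_mod_cast hn)
  set A := γ '' Θos n with hA
  set C := γp '' Θos n with hC
  set ψ : Θ → Euc d × Euc k := fun θ => (γ θ, γp θ) with hψdef
  have hD : ψ '' Θos n ⊆ Metric.ball 0 ρ ∩ Γ ×ˢ Γp := by
    rintro _ ⟨θ, hθ, rfl⟩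
    refine ⟨?_, hrep.mapsTo θ (hsub hθ)⟩
    rw [mem_ball_zero_iff]
    linarith [hshrink θ hθ]
  have hgm : Measurable fun a : Euc d => gaussKernel v (Real.sqrt n • a) :=
    (measurable_gaussKernel v).comp (by fun_prop)
  have hFm : Measurable fun x : Euc d × Euc k => gaussKernel v (Real.sqrt n • x.1) * h x.2 :=
    (hgm.comp measurable_fst).mul (hh.comp measurable_snd)
  have hTn : (fun a => Real.sqrt n • a) '' A = (fun θ => Real.sqrt n • γ θ) '' Θos n := by
    rw [hA, Set.image_image]
  -- The singular integral `Y` and the Jacobian `σ` multiply both the upper and the lower bound, so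
  -- no division by them, and no finiteness of `Y`, is required.
  set Y := ∫⁻ y in C, h y
  set σ := ENNReal.ofReal |((Real.sqrt n) ^ d)⁻¹|
  have hup : ∫⁻ θ in Θos n ∩ {θ | ‖v - Real.sqrt n • γ θ‖ ^ 2 ≤ z + δ},
      gaussKernel v (Real.sqrt n • γ θ) * h (γp θ) ∂prior ≤
      ENNReal.ofReal ((1 + ε) * p₀) * (σ * (∫⁻ x in (fun θ => Real.sqrt n • γ θ) '' Θos n ∩
        {x | ‖v - x‖ ^ 2 ≤ z + δ}, gaussKernel v x) * Y) := by
    refine (setLIntegral_comp_le_of_map_restrict_le (ν := volume) hψ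
      (Set.inter_subset_left.trans hsub)
      (Metric.isOpen_ball.measurableSet.inter (hrep.measurableSet_Γ.prod hrep.measurableSet_Γp))
      ((Set.image_mono Set.inter_subset_left).trans hD) hhi hFm).trans ?_
    gcongr
    have hsub' : ψ '' (Θos n ∩ {θ | ‖v - Real.sqrt n • γ θ‖ ^ 2 ≤ z + δ}) ⊆
        (A ∩ (fun a => Real.sqrt n • a) ⁻¹' {x | ‖v - x‖ ^ 2 ≤ z + δ}) ×ˢ C := by
      rintro _ ⟨θ, hθ, rfl⟩
      exact ⟨⟨Set.mem_image_of_mem _ hθ.1, hθ.2⟩, Set.mem_image_of_mem _ hθ.1⟩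
    refine (lintegral_mono_set hsub').trans (le_of_eq ?_)
    rw [setLIntegral_prod_mul hgm hh, setLIntegral_comp_smul hsqrt, Set.image_inter_preimage, hTn]
  have hdown : ENNReal.ofReal p₀ * (σ * (∫⁻ x in (fun θ => Real.sqrt n • γ θ) '' Θos n ∩
        Metric.closedBall 0 (r n), gaussKernel v x) * Y) ≤
      ∫⁻ θ in Θos n, gaussKernel v (Real.sqrt n • γ θ) * h (γp θ) ∂prior := by
    have hI' : NullMeasurableSet (ψ '' Θos n) volume := by
      rw [hprod]
      exact hnull.1.prod hnull.2
    have hG : MeasurableSet {x : Euc d × Euc k | Real.sqrt n * ‖x.1‖ ≤ r n} :=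
      (isClosed_le (by fun_prop) continuous_const).measurableSet
    refine le_trans (le_of_eq ?_) (le_setLIntegral_comp_of_le_map_restrict (ν := volume) hψ hD hlo
      hFm hI' hG hsat)
    congr 1
    have e : ψ '' Θos n ∩ {x : Euc d × Euc k | Real.sqrt n * ‖x.1‖ ≤ r n} =
        (A ∩ (fun a => Real.sqrt n • a) ⁻¹' Metric.closedBall 0 (r n)) ×ˢ C := by
      rw [hprod]
      ext x
      simp only [Set.mem_inter_iff, Set.mem_prod, Set.mem_ofPred_eq, Set.mem_preimage,
        mem_closedBall_zero_iff, norm_smul, Real.norm_of_nonneg hsqrt.le]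
      tauto
    rw [e, setLIntegral_prod_mul hgm hh, setLIntegral_comp_smul hsqrt, Set.image_inter_preimage,
      hTn]
  have hX := hcov v hv hvM z
  rw [hcv, hcv, mul_left_comm, ENNReal.mul_le_mul_iff_right (ENNReal.ofReal_pos.2 hc).ne'
    ENNReal.ofReal_ne_top] at hX
  refine hup.trans ?_
  refine le_trans ?_ (mul_le_mul_right hdown _)
  have hs0 : 0 ≤ shiftedConeCDF T v z := measureReal_nonneg
  rw [ENNReal.ofReal_mul (by positivity : 0 ≤ 1 + ε), ENNReal.ofReal_mul (by positivity : 0 ≤ 1 + ε)]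
  calc _ ≤ ENNReal.ofReal (1 + ε) * ENNReal.ofReal p₀ *
        (σ * (ENNReal.ofReal (shiftedConeCDF T v z + ε) * _) * Y) := by gcongr
    _ = _ := by ring

end LocalIntegrals

/-! ### Consequences of the quadratic expansion for a realized criterion -/

section Realized

variable {Θ : Type*} {d k : ℕ} {n : ℕ} {L : Θ → EReal} {θhat : Θ} {S : Set Θ} {ℓ ε : ℝ}
  {γhat : Euc d} {f : Euc k → ℝ} {γ : Θ → Euc d} {γp : Θ → Euc k}

/-- The criterion `L` satisfies the local expansion on `S` up to `ε`, and `n L (θhat)` equals the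
unconstrained maximum of the expansion up to `3 ε`. -/
def ExpansionHolds (n : ℕ) (L : Θ → EReal) (θhat : Θ) (S : Set Θ) (ℓ : ℝ) (γhat : Euc d)
    (f : Euc k → ℝ) (γ : Θ → Euc d) (γp : Θ → Euc k) (ε : ℝ) : Prop :=
  ∃ m : ℝ, L θhat = m ∧ |n * m - (ℓ + 1 / 2 * ‖Real.sqrt n • γhat‖ ^ 2)| ≤ 3 * ε ∧
    ∀ θ ∈ S, 0 ≤ f (γp θ) ∧
      ∃ l : ℝ, L θ = l ∧ |n * l - localExpansion n ℓ γhat f γ γp θ| ≤ ε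

theorem localExpansion_eq (θ : Θ) : localExpansion n ℓ γhat f γ γp θ =
    ℓ + 1 / 2 * ‖Real.sqrt n • γhat‖ ^ 2 -
      1 / 2 * ‖Real.sqrt n • γhat - Real.sqrt n • γ θ‖ ^ 2 - f (γp θ) := by
  rw [localExpansion, smul_sub]

theorem exists_real_of_mul_mem {n : ℕ} (hn : 1 ≤ n) {x : EReal} {a b : ℝ}
    (hb : (n : EReal) * x ≤ (b : ℝ)) (ha : (a : ℝ) ≤ (n : EReal) * x) :
    ∃ l : ℝ, x = l ∧ a ≤ n * l ∧ n * l ≤ b := by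
  have hn' : (0 : ℝ) < n := by exact_mod_cast hn
  rw [← EReal.coe_coe_eq_natCast] at ha hb
  induction x with
  | bot =>
    rw [EReal.coe_mul_bot_of_pos hn'] at ha
    exact absurd ha (by simp)
  | top =>
    rw [EReal.coe_mul_top_of_pos hn'] at hb
    exact absurd hb (by simp)
  | coe l =>
    rw [← EReal.coe_mul, EReal.coe_le_coe_iff] at ha hb
    exact ⟨l, rfl, ha, hb⟩

/-- The supremum of `n L` over `S` is at most the unconstrained maximum plus `ε`, and the
approximate maximization adds `ε`. From below, the near point loses `ε` in the quadratic term, `ε`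
in the expansion and `ε` in the maximization; hence `3 ε`. -/
theorem expansionHolds_of_approx (hn : 1 ≤ n) (hε : 0 ≤ ε)
    (hexp : ∀ θ ∈ S, (n : EReal) * L θ ≤
        ((localExpansion n ℓ γhat f γ γp θ + ε : ℝ) : EReal) ∧
      ((localExpansion n ℓ γhat f γ γp θ - ε : ℝ) : EReal) ≤ (n : EReal) * L θ)
    (hmax : L θhat ≤ (⨆ θ ∈ S, L θ) + ((ε * (n : ℝ)⁻¹ : ℝ) : EReal) ∧
      (⨆ θ ∈ S, L θ) ≤ L θhat + ((ε * (n : ℝ)⁻¹ : ℝ) : EReal))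
    (hf : ∀ θ ∈ S, 0 ≤ f (γp θ))
    (hnear : ∃ θ ∈ S, ‖Real.sqrt n • γhat - Real.sqrt n • γ θ‖ ^ 2 ≤ 2 * ε ∧ f (γp θ) = 0) :
    ExpansionHolds n L θhat S ℓ γhat f γ γp ε := by
  have hn' : (0 : ℝ) < n := by exact_mod_cast hn
  set κ := ℓ + 1 / 2 * ‖Real.sqrt n • γhat‖ ^ 2 with hκ
  have hreal : ∀ θ ∈ S, ∃ l : ℝ, L θ = l ∧ localExpansion n ℓ γhat f γ γp θ - ε ≤ n * l ∧
      n * l ≤ localExpansion n ℓ γhat f γ γp θ + ε := fun θ hθ =>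
    exists_real_of_mul_mem hn (hexp θ hθ).1 (hexp θ hθ).2
  have hY : (⨆ θ ∈ S, L θ) ≤ (((κ + ε) / n : ℝ) : EReal) := by
    refine iSup₂_le fun θ hθ => ?_
    obtain ⟨l, hl, -, h2⟩ := hreal θ hθ
    rw [hl, EReal.coe_le_coe_iff, le_div_iff₀ hn', mul_comm]
    rw [localExpansion_eq] at h2
    nlinarith [hf θ hθ, sq_nonneg ‖Real.sqrt n • γhat - Real.sqrt n • γ θ‖]
  have hup : L θhat ≤ (((κ + ε) / n + ε * (n : ℝ)⁻¹ : ℝ) : EReal) := by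
    refine hmax.1.trans ?_
    rw [EReal.coe_add]
    gcongr
  obtain ⟨θ, hθ, hθ1, hθ2⟩ := hnear
  obtain ⟨l, hl, h1, -⟩ := hreal θ hθ
  have hdown : (l : EReal) ≤ L θhat + ((ε * (n : ℝ)⁻¹ : ℝ) : EReal) :=
    (hl ▸ le_iSup₂ (f := fun θ (_ : θ ∈ S) => L θ) θ hθ).trans hmax.2
  obtain ⟨m, hm⟩ : ∃ m : ℝ, L θhat = m := by
    induction h : L θhat with
    | bot => simp [h] at hdown
    | top => exact absurd (h ▸ hup) (not_le.2 (EReal.coe_lt_top _))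
    | coe m => exact ⟨m, rfl⟩
  rw [hm, EReal.coe_le_coe_iff] at hup
  rw [hm, ← EReal.coe_add, EReal.coe_le_coe_iff] at hdown
  refine ⟨m, hm, ?_, fun θ hθ => ⟨hf θ hθ, ?_⟩⟩
  · have e1 : n * ((κ + ε) / n + ε * (n : ℝ)⁻¹) = κ + 2 * ε := by field_simp; ring
    have e2 : n * (m + ε * (n : ℝ)⁻¹) = n * m + ε := by field_simp
    have h3 := mul_le_mul_of_nonneg_left hup hn'.le
    have h4 := mul_le_mul_of_nonneg_left hdown hn'.le
    rw [e1] at h3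
    rw [e2] at h4
    rw [localExpansion_eq, hθ2] at h1
    rw [abs_le]
    constructor <;> linarith
  · obtain ⟨l, hl, h1, h2⟩ := hreal θ hθ
    exact ⟨l, hl, by rw [abs_le]; constructor <;> linarith⟩

theorem qlr_eq_coe {m l : ℝ} {θ : Θ} (hm : L θhat = m) (hl : L θ = l) :
    qlr n L θhat θ = ((2 * (n * m - n * l) : ℝ) : EReal) := by
  rw [qlr, hm, hl, ← EReal.coe_coe_eq_natCast, ← EReal.coe_sub,
    show (2 : EReal) = ((2 : ℝ) : EReal) from rfl, ← EReal.coe_mul, ← EReal.coe_mul]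
  congr 1
  ring

/-- The nonnegative singular term is dropped here, which is why the domination is one-sided. The
constant is `2 * (3 + 1)`. -/
theorem ExpansionHolds.norm_sq_le (h : ExpansionHolds n L θhat S ℓ γhat f γ γp ε) {θ : Θ}
    (hθ : θ ∈ S) {z : ℝ} (hz : qlr n L θhat θ ≤ (z : EReal)) :
    ‖Real.sqrt n • γhat - Real.sqrt n • γ θ‖ ^ 2 ≤ z + 8 * ε := by
  obtain ⟨m, hm, hmb, hS⟩ := h
  obtain ⟨hf, l, hl, hlb⟩ := hS θ hθ
  rw [qlr_eq_coe hm hl, EReal.coe_le_coe_iff] at hz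
  rw [localExpansion_eq] at hlb
  rw [abs_le] at hmb hlb
  linarith [hmb.1, hlb.2]

theorem ExpansionHolds.qlr_le (h : ExpansionHolds n L θhat S ℓ γhat f γ γp ε) {θ : Θ}
    (hθ : θ ∈ S) (hγ : γ θ = 0) (hγp : f (γp θ) = 0) :
    ∃ m l : ℝ, L θhat = m ∧ L θ = l ∧
      2 * (n * m - n * l) ≤ ‖Real.sqrt n • γhat‖ ^ 2 + 8 * ε := by
  obtain ⟨m, hm, hmb, hS⟩ := h
  obtain ⟨-, l, hl, hlb⟩ := hS θ hθ
  refine ⟨m, l, hm, hl, ?_⟩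
  rw [localExpansion_eq, hγ, hγp, smul_zero, sub_zero (Real.sqrt n • γhat)] at hlb
  rw [abs_le] at hmb hlb
  linarith [hmb.2, hlb.1]

/-- The random level `ℓ + ‖√n γ̂‖² / 2` enters the two bounds with opposite signs and cancels in
posterior ratios, leaving the factor `exp (2 ε)`. -/
theorem ExpansionHolds.exp_mem (h : ExpansionHolds n L θhat S ℓ γhat f γ γp ε) {θ : Θ}
    (hθ : θ ∈ S) :
    EReal.exp ((n : EReal) * L θ) ≤
        ENNReal.ofReal (Real.exp (ℓ + 1 / 2 * ‖Real.sqrt n • γhat‖ ^ 2 + ε)) *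
          (gaussKernel (Real.sqrt n • γhat) (Real.sqrt n • γ θ) *
            ENNReal.ofReal (Real.exp (-f (γp θ)))) ∧
      gaussKernel (Real.sqrt n • γhat) (Real.sqrt n • γ θ) *
            ENNReal.ofReal (Real.exp (-f (γp θ))) ≤
        ENNReal.ofReal (Real.exp (-(ℓ + 1 / 2 * ‖Real.sqrt n • γhat‖ ^ 2) + ε)) *
          EReal.exp ((n : EReal) * L θ) := by
  obtain ⟨-, -, -, hS⟩ := h
  obtain ⟨-, l, hl, hlb⟩ := hS θ hθ
  rw [localExpansion_eq, abs_le] at hlb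
  have e : EReal.exp ((n : EReal) * L θ) = ENNReal.ofReal (Real.exp (n * l)) := by
    rw [hl, ← EReal.coe_coe_eq_natCast, ← EReal.coe_mul, EReal.exp_coe]
  rw [e, gaussKernel, ← ENNReal.ofReal_mul (Real.exp_pos _).le, ← Real.exp_add,
    ← ENNReal.ofReal_mul (Real.exp_pos _).le, ← Real.exp_add,
    ← ENNReal.ofReal_mul (Real.exp_pos _).le, ← Real.exp_add]
  constructor <;> refine ENNReal.ofReal_le_ofReal (Real.exp_le_exp.2 ?_)
  · linarith [hlb.2]
  · linarith [hlb.1]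

end Realized

section Posterior

variable {Θ : Type*} [MeasurableSpace Θ] {d k : ℕ} {n : ℕ} {L : Θ → EReal} {θhat : Θ} {S : Set Θ}
  {ℓ ε : ℝ} {γhat : Euc d} {f : Euc k → ℝ} {γ : Θ → Euc d} {γp : Θ → Euc k} {prior : Measure Θ}

theorem quasiPosterior_le {B : Set Θ} (hB : MeasurableSet B) {c : ℝ≥0∞}
    (h : ∫⁻ θ in B, EReal.exp ((n : EReal) * L θ) ∂prior ≤
      c * ∫⁻ θ, EReal.exp ((n : EReal) * L θ) ∂prior) :
    quasiPosterior prior n L B ≤ c := by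
  rw [quasiPosterior, Measure.smul_apply, withDensity_apply _ hB, smul_eq_mul]
  refine (mul_le_mul_right h _).trans ?_
  rw [mul_left_comm]
  -- In `ℝ≥0∞` the bound `x⁻¹ * x ≤ 1` also covers `x = 0` and `x = ∞`.
  exact mul_le_of_le_one_right' (ENNReal.inv_mul_le_one _)

/-- The quasi-posterior distribution function of the QLR is bounded through the local integrals. -/
theorem ExpansionHolds.posteriorQLR_le (h : ExpansionHolds n L θhat S ℓ γhat f γ γp ε)
    (hS : MeasurableSet S) (hγ : Measurable γ) {z δ c η : ℝ} (hδ : 8 * ε ≤ δ) (hc : 0 ≤ c)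
    (hη : 0 ≤ η)
    (hloc : ∫⁻ θ in S ∩ {θ | ‖Real.sqrt n • γhat - Real.sqrt n • γ θ‖ ^ 2 ≤ z + δ},
        gaussKernel (Real.sqrt n • γhat) (Real.sqrt n • γ θ) *
          ENNReal.ofReal (Real.exp (-f (γp θ))) ∂prior ≤
      ENNReal.ofReal c * ∫⁻ θ in S, gaussKernel (Real.sqrt n • γhat) (Real.sqrt n • γ θ) *
          ENNReal.ofReal (Real.exp (-f (γp θ))) ∂prior)
    (hcontr : quasiPosterior prior n L Sᶜ ≤ ENNReal.ofReal η) :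
    posteriorQLR prior n L θhat z ≤ Real.exp (2 * ε) * c + η := by
  set B := S ∩ {θ | ‖Real.sqrt n • γhat - Real.sqrt n • γ θ‖ ^ 2 ≤ z + δ} with hB
  have hBm : MeasurableSet B := by
    refine hS.inter (measurableSet_le ?_ measurable_const)
    fun_prop
  set κ := ℓ + 1 / 2 * ‖Real.sqrt n • γhat‖ ^ 2 with hκ
  have h1 : ∫⁻ θ in B, EReal.exp ((n : EReal) * L θ) ∂prior ≤
      ENNReal.ofReal (Real.exp (2 * ε) * c) * ∫⁻ θ, EReal.exp ((n : EReal) * L θ) ∂prior := by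
    calc ∫⁻ θ in B, EReal.exp ((n : EReal) * L θ) ∂prior
        ≤ ∫⁻ θ in B, ENNReal.ofReal (Real.exp (κ + ε)) *
          (gaussKernel (Real.sqrt n • γhat) (Real.sqrt n • γ θ) *
            ENNReal.ofReal (Real.exp (-f (γp θ)))) ∂prior :=
          setLIntegral_mono' hBm fun θ hθ => (h.exp_mem hθ.1).1
      _ = ENNReal.ofReal (Real.exp (κ + ε)) * ∫⁻ θ in B,
          (gaussKernel (Real.sqrt n • γhat) (Real.sqrt n • γ θ) *
            ENNReal.ofReal (Real.exp (-f (γp θ)))) ∂prior :=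
          lintegral_const_mul' _ _ ENNReal.ofReal_ne_top
      _ ≤ ENNReal.ofReal (Real.exp (κ + ε)) * (ENNReal.ofReal c * ∫⁻ θ in S,
          ENNReal.ofReal (Real.exp (-κ + ε)) * EReal.exp ((n : EReal) * L θ) ∂prior) := by
          refine mul_le_mul_right (hloc.trans (mul_le_mul_right ?_ _)) _
          exact setLIntegral_mono' hS fun θ hθ => (h.exp_mem hθ).2
      _ = ENNReal.ofReal (Real.exp (2 * ε) * c) *
          ∫⁻ θ in S, EReal.exp ((n : EReal) * L θ) ∂prior := by
          rw [lintegral_const_mul' _ _ ENNReal.ofReal_ne_top, ← mul_assoc, ← mul_assoc,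
            ← ENNReal.ofReal_mul (Real.exp_pos _).le,
            ← ENNReal.ofReal_mul (mul_nonneg (Real.exp_pos _).le hc)]
          congr 2
          rw [mul_right_comm, ← Real.exp_add]
          congr 2
          ring
      _ ≤ _ := mul_le_mul_right (setLIntegral_le_lintegral _ _) _
  have h2 : quasiPosterior prior n L {θ | qlr n L θhat θ ≤ (z : EReal)} ≤
      ENNReal.ofReal (Real.exp (2 * ε) * c + η) := by
    rw [ENNReal.ofReal_add (by positivity) hη]
    refine le_trans ?_ (add_le_add (quasiPosterior_le hBm h1) hcontr)
    refine (measure_mono fun θ hθ => ?_).trans (measure_union_le _ _)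
    by_cases hθS : θ ∈ S
    · exact Or.inl ⟨hθS, (h.norm_sq_le hθS hθ).trans (by gcongr)⟩
    · exact Or.inr hθS
  exact ENNReal.toReal_le_of_le_ofReal (by positivity) h2

end Posterior

/-! ### Events of probability tending to one -/

section Tightness

variable {Ω : Type*} [MeasurableSpace Ω] {P : Measure Ω} [IsProbabilityMeasure P] {d : ℕ}
  {V : ℕ → Ω → Euc d} {μ : Measure (Euc d)} [IsProbabilityMeasure μ]

theorem eventually_measure_lt_of_tendstoInDistribution
    (hV : TendstoInDistribution V atTop (fun x : Euc d => x) (fun _ => P) μ) {F : Set (Euc d)}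
    (hF : IsClosed F) {τ : ℝ≥0∞} (hτ : μ F < τ) :
    ∀ᶠ n in atTop, P {ω | V n ω ∈ F} < τ := by
  have h := ProbabilityMeasure.limsup_measure_closed_le_of_tendsto hV.tendsto hF
  have h2 := eventually_lt_of_limsup_lt (lt_of_le_of_lt h (by
    change (μ.map fun x => x) F < τ
    rwa [Measure.map_id']))
  filter_upwards [h2] with n hn
  change (P.map (V n)) F < τ at hn
  rwa [Measure.map_apply_of_aemeasurable (hV.forall_aemeasurable n) hF.measurableSet] at hn

theorem exists_eventually_measure_norm_le
    (hV : TendstoInDistribution V atTop (fun x : Euc d => x) (fun _ => P) μ) {τ : ℝ≥0∞}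
    (hτ : 0 < τ) : ∃ M : ℝ, ∀ᶠ n in atTop, P {ω | M < ‖V n ω‖} ≤ τ := by
  have h := tendsto_measure_compl_closedBall μ (r := fun n : ℕ => (n : ℝ))
    tendsto_natCast_atTop_atTop
  obtain ⟨N, hN⟩ := (h.eventually (gt_mem_nhds hτ)).exists
  -- The extra `1` leaves room for a closed set inside the open complement of the ball, as the
  -- portmanteau bound requires.
  refine ⟨N + 1, ?_⟩
  have hF : IsClosed {x : Euc d | (N : ℝ) + 1 ≤ ‖x‖} := isClosed_le continuous_const continuous_norm
  have hlt : μ {x : Euc d | (N : ℝ) + 1 ≤ ‖x‖} < τ := by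
    refine lt_of_le_of_lt (measure_mono fun x hx => ?_) hN
    rw [Set.mem_compl_iff, mem_closedBall_zero_iff, not_le]
    linarith [show (N : ℝ) + 1 ≤ ‖x‖ from hx]
  filter_upwards [eventually_measure_lt_of_tendstoInDistribution hV hF hlt] with n hn
  refine le_trans (measure_mono ?_) hn.le
  intro ω hω
  exact le_of_lt (show (N : ℝ) + 1 < ‖V n ω‖ from hω)

end Tightness

section SupDiff

variable {Ω : Type*} [MeasurableSpace Ω] {P : Measure Ω}

theorem SupDiffLeOP.mono_right {F G H : ℕ → Ω → ℝ → ℝ} (h : SupDiffLeOP P F G)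
    (hGH : ∀ n ω z, G n ω z ≤ H n ω z) : SupDiffLeOP P F H := fun ε hε =>
  tendsto_of_tendsto_of_tendsto_of_le_of_le tendsto_const_nhds (h ε hε) (fun _ => zero_le) fun n =>
    measure_mono fun ω hω hn => hω fun z => by linarith [hn z, hGH n ω z]

end SupDiff

theorem shiftedConeCDF_le_one {d : ℕ} (T : ProperCone ℝ (Euc d)) (v : Euc d) (z : ℝ) :
    shiftedConeCDF T v z ≤ 1 :=
  (shiftedConeCDF_le_coneCDF T v z).trans measureReal_le_one

/-! ### Asymptotic domination of the posterior of the QLR. -/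

section Main

variable {Ω Θ : Type*} [MeasurableSpace Ω] [TopologicalSpace Θ] [MeasurableSpace Θ]
  {P : Measure Ω} [IsProbabilityMeasure P] {d k : ℕ} {Ln : ℕ → Ω → Θ → EReal} {prior : Measure Θ}
  {θhat : ℕ → Ω → Θ} {ΘI ΘN : Set Θ} {Θos : ℕ → Set Θ} {γ : Θ → Euc d} {γp : Θ → Euc k}
  {Γ : Set (Euc d)} {Γp : Set (Euc k)} {T : ProperCone ℝ (Euc d)}
  {ℓ : ℕ → Ω → ℝ} {γhat V : ℕ → Ω → Euc d} {f : ℕ → Ω → Euc k → ℝ} {S : Matrix (Fin d) (Fin d) ℝ}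

/-- If `V` is bounded, points of the local parameter set come close to its projection. -/
theorem LocalReparam.eventually_exists_near
    (hrep : LocalReparam prior ΘI ΘN Θos γ γp Γ Γp T) (hI : ΘI.Nonempty)
    (hprod : ∀ᶠ n in atTop,
      (fun θ => (γ θ, γp θ)) '' Θos n = (γ '' Θos n) ×ˢ (γp '' Θos n))
    (M : ℝ) {ε : ℝ} (hε : 0 < ε) :
    ∀ᶠ n : ℕ in atTop, ∀ v ∈ T, ‖v‖ ≤ M →
      ∃ θ ∈ Θos n, ‖v - Real.sqrt n • γ θ‖ ^ 2 ≤ 2 * ε ∧ γp θ = 0 := by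
  filter_upwards [hrep.covers.1 M ε hε, hprod] with n hn hprod v hv hvM
  obtain ⟨θ₀, hθ₀⟩ := hI
  have hne : Nonempty ((fun θ => Real.sqrt n • γ θ) '' Θos n) :=
    ⟨⟨_, Set.mem_image_of_mem _ (hrep.subset_os n hθ₀)⟩⟩
  have h0 : (⨅ a : (T : Set (Euc d)), ‖(a : Euc d) - v‖ ^ 2) ≤ 0 := by
    refine (ciInf_le ⟨0, ?_⟩ (⟨v, hv⟩ : (T : Set (Euc d)))).trans (by simp)
    rintro _ ⟨a, rfl⟩
    positivity
  have h1 := (abs_le.1 (hn v hvM)).2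
  obtain ⟨⟨_, θ₁, hθ₁, rfl⟩, ha⟩ := exists_lt_of_ciInf_lt (lt_of_le_of_lt
    (show _ ≤ ε by linarith) (show ε < 2 * ε by linarith))
  -- By the product structure the singular coordinate can be reset to `0`, where `f` vanishes,
  -- without moving the regular one.
  have hmem : (γ θ₁, (0 : Euc k)) ∈ (fun θ => (γ θ, γp θ)) '' Θos n := by
    rw [hprod]
    exact ⟨Set.mem_image_of_mem _ hθ₁, θ₀, hrep.subset_os n hθ₀, (hrep.eq_zero hθ₀).2⟩
  obtain ⟨θ, hθ, he⟩ := hmem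
  refine ⟨θ, hθ, ?_, congrArg Prod.snd he⟩
  rw [show γ θ = γ θ₁ from congrArg Prod.fst he, norm_sub_rev]
  exact ha.le

/-- Tightness of `V` confines its projection to a bounded part of `T`, where the covering supplies
near points uniformly. This turns the expansion and the approximate maximization into a statement
about `n L (θhat)` itself. -/
theorem tendsto_measure_not_expansionHolds (hrep : LocalReparam prior ΘI ΘN Θos γ γp Γ Γp T)
    (hI : ΘI.Nonempty) (hrate : PosteriorContraction P prior Ln θhat Θos)
    (hquad : LocalQuadraticSingular P Ln Θos γ γp Γp T ℓ γhat V f S) {ε : ℝ} (hε : 0 < ε) :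
    Tendsto (fun n : ℕ => P {ω | ¬ (Real.sqrt n • γhat n ω = coneProj T (V n ω) ∧ f n ω 0 = 0 ∧
      ExpansionHolds n (Ln n ω) (θhat n ω) (Θos n) (ℓ n ω) (γhat n ω) (f n ω) γ γp ε)})
      atTop (𝓝 0) := by
  rw [ENNReal.tendsto_nhds_zero]
  intro τ hτ
  have hτ3 : 0 < τ / 3 := ENNReal.div_pos hτ.ne' (by simp)
  obtain ⟨M, hM⟩ := exists_eventually_measure_norm_le hquad.weak_limit hτ3
  filter_upwards [hM, hrep.eventually_exists_near hI hquad.product M hε,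
    ENNReal.tendsto_nhds_zero.1 (hquad.expansion ε hε) _ hτ3,
    ENNReal.tendsto_nhds_zero.1 (hrate.approx_max ε hε) _ hτ3,
    hrep.os_subset, eventually_ge_atTop 1] with n hM hnear hexp hmax hsub hn
  have hγ : P {ω | ¬ Real.sqrt n • γhat n ω = coneProj T (V n ω)} = 0 :=
    ae_iff.1 (hquad.γhat_eq n hn)
  have hf0 : P {ω | ¬ f n ω 0 = 0} = 0 := ae_iff.1 (hquad.f_zero n)
  refine (measure_mono (t := {ω | ¬ Real.sqrt n • γhat n ω = coneProj T (V n ω)} ∪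
    ({ω | ¬ f n ω 0 = 0} ∪ ({ω | M < ‖V n ω‖} ∪ ({ω | ¬ ∀ θ ∈ Θos n,
      (n : EReal) * Ln n ω θ ≤
        ((localExpansion n (ℓ n ω) (γhat n ω) (f n ω) γ γp θ + ε : ℝ) : EReal) ∧
      ((localExpansion n (ℓ n ω) (γhat n ω) (f n ω) γ γp θ - ε : ℝ) : EReal) ≤
        (n : EReal) * Ln n ω θ} ∪ {ω | ¬ (Ln n ω (θhat n ω) ≤ (⨆ θ ∈ Θos n, Ln n ω θ) +
        ((ε * (n : ℝ)⁻¹ : ℝ) : EReal) ∧ (⨆ θ ∈ Θos n, Ln n ω θ) ≤ Ln n ω (θhat n ω) +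
        ((ε * (n : ℝ)⁻¹ : ℝ) : EReal))})))) ?_).trans ?_
  · intro ω hω
    by_contra hgood
    simp only [Set.mem_union, Set.mem_ofPred_eq, not_or, not_not, not_lt] at hgood
    obtain ⟨h1, h2, h3, h4, h5⟩ := hgood
    refine hω ⟨h1, h2, expansionHolds_of_approx hn hε.le h4 h5
      (fun θ hθ => hquad.f_nonneg n ω _ (hrep.mapsTo θ (hsub hθ)).2) ?_⟩
    obtain ⟨θ, hθ, hd, h0⟩ := hnear (Real.sqrt n • γhat n ω) (h1 ▸ coneProj_mem T _)
      (h1 ▸ (norm_coneProj_le T _).trans h3)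
    exact ⟨θ, hθ, hd, by rw [h0, h2]⟩
  · refine (measure_union_le _ _).trans ?_
    rw [hγ, zero_add]
    refine (measure_union_le _ _).trans ?_
    rw [hf0, zero_add]
    refine (measure_union_le _ _).trans ?_
    refine (add_le_add hM ((measure_union_le _ _).trans (add_le_add hexp hmax))).trans ?_
    rw [← add_assoc, ENNReal.add_thirds]

/-- The quasi-posterior distribution function of the QLR is asymptotically dominated by that of a
Gaussian vector conditioned on the shifted cone. -/
theorem supDiffLeOP_shiftedConeCDF (hd : 1 ≤ d) (hT : 0 < volume (T : Set (Euc d)))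
    (hrep : LocalReparam prior ΘI ΘN Θos γ γp Γ Γp T)
    (hI : ΘI.Nonempty) (hrate : PosteriorContraction P prior Ln θhat Θos)
    (hquad : LocalQuadraticSingular P Ln Θos γ γp Γp T ℓ γhat V f S)
    (hprior : PriorSingular P prior Ln ΘN γ γp Γ Γp) :
    SupDiffLeOP P (fun n ω => posteriorQLR prior n (Ln n ω) (θhat n ω))
      (fun n ω => shiftedConeCDF T (Real.sqrt n • γhat n ω)) := by
  intro ε₀ hε₀
  rw [ENNReal.tendsto_nhds_zero]
  intro τ hτ
  have hτ3 : 0 < τ / 3 := ENNReal.div_pos hτ.ne' (by simp)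
  obtain ⟨M, hM⟩ := exists_eventually_measure_norm_le hquad.weak_limit hτ3
  -- For `s, ε ≤ 1` the final bound is `(1 + ε)² (s + ε) + ε ≤ s + 8 ε`.
  obtain ⟨ε, hε, hε1, hεε⟩ : ∃ ε : ℝ, 0 < ε ∧ ε ≤ 1 ∧ 8 * ε ≤ ε₀ :=
    ⟨min 1 (ε₀ / 8), lt_min one_pos (by positivity), min_le_left _ _,
      (le_div_iff₀' (by norm_num)).1 (min_le_right _ _)⟩
  obtain ⟨δ, hδ, hloc⟩ := hrep.exists_setLIntegral_le hprior hd hT hI hquad.shrink hquad.product M hε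
  -- The expansion error is chosen after `δ`: `8 ε'` must fit in the slack of the radius and `exp (2
  -- ε')` in the factor `1 + ε`.
  obtain ⟨ε', hε', hε'δ, hε'e⟩ : ∃ ε' : ℝ, 0 < ε' ∧ 8 * ε' ≤ δ ∧ Real.exp (2 * ε') ≤ 1 + ε := by
    have h1 := min_le_left (δ / 8) (Real.log (1 + ε) / 2)
    have h2 := min_le_right (δ / 8) (Real.log (1 + ε) / 2)
    refine ⟨min (δ / 8) (Real.log (1 + ε) / 2), lt_min (by positivity)
      (half_pos (Real.log_pos (by linarith))), by linarith, ?_⟩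
    rw [← Real.le_log_iff_exp_le (by linarith)]
    linarith
  filter_upwards [hM, hloc,
    ENNReal.tendsto_nhds_zero.1 (tendsto_measure_not_expansionHolds hrep hI hrate hquad hε') _ hτ3,
    ENNReal.tendsto_nhds_zero.1 (hrate.contraction ε hε) _ hτ3] with n hM hloc hexp hcontr
  refine (measure_mono (t := {ω | M < ‖V n ω‖} ∪ ({ω | ¬ (Real.sqrt n • γhat n ω =
      coneProj T (V n ω) ∧ f n ω 0 = 0 ∧
      ExpansionHolds n (Ln n ω) (θhat n ω) (Θos n) (ℓ n ω) (γhat n ω) (f n ω) γ γp ε')} ∪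
    {ω | ENNReal.ofReal ε < quasiPosterior prior n (Ln n ω) (Θos n)ᶜ})) ?_).trans ?_
  · intro ω hω
    by_contra hgood
    simp only [Set.mem_union, Set.mem_ofPred_eq, not_or, not_not, not_lt] at hgood
    obtain ⟨h1, ⟨h2, h3, h4⟩, h5⟩ := hgood
    refine hω fun z => ?_
    have hv : Real.sqrt n • γhat n ω ∈ T := h2 ▸ coneProj_mem T _
    have hs0 : 0 ≤ shiftedConeCDF T (Real.sqrt n • γhat n ω) z := measureReal_nonneg
    have hs1 := shiftedConeCDF_le_one T (Real.sqrt n • γhat n ω) z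
    have hfm : Measurable (f n ω) := (hquad.measurable_f n).comp measurable_prodMk_left
    have hl := hloc (Real.sqrt n • γhat n ω) hv (h2 ▸ (norm_coneProj_le T _).trans h1)
      (fun y => ENNReal.ofReal (Real.exp (-f n ω y))) (by fun_prop) z
    have h6 := h4.posteriorQLR_le (hrep.measurableSet_os n) hrep.measurable_γ hε'δ (by positivity)
      hε.le hl h5
    set s := shiftedConeCDF T (Real.sqrt n • γhat n ω) z
    have h7 : Real.exp (2 * ε') * ((1 + ε) * (s + ε)) ≤ (1 + ε) * ((1 + ε) * (s + ε)) :=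
      mul_le_mul_of_nonneg_right hε'e (by positivity)
    have h8 : (1 + ε) * (1 + ε) ≤ 1 + 3 * ε := by nlinarith
    have h9 : (1 + ε) * (1 + ε) * (s + ε) ≤ (1 + 3 * ε) * (s + ε) :=
      mul_le_mul_of_nonneg_right h8 (by positivity)
    have h10 : ε * s ≤ ε := by nlinarith
    have h11 : ε * ε ≤ ε := by nlinarith
    linarith
  · refine (measure_union_le _ _).trans ?_
    refine (add_le_add hM ((measure_union_le _ _).trans (add_le_add hexp hcontr))).trans ?_
    rw [← add_assoc, ENNReal.add_thirds]

end Main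

/-! ### Quantiles -/

section Quantile

theorem quantile_le {F : ℝ → ℝ} {α c : ℝ} (h : α ≤ F c) : quantile F α ≤ (c : EReal) :=
  sInf_le ⟨c, h, rfl⟩

/-- The values at `a` and `b` keep the infimum away from `±∞`. Without right-continuity the level
`α` is reached only strictly to the right of `q`. -/
theorem exists_quantile_eq_coe {F : ℝ → ℝ} (hF : Monotone F) {α a b : ℝ} (ha : F a < α)
    (hb : α ≤ F b) :
    ∃ q : ℝ, quantile F α = q ∧ (∀ z < q, F z < α) ∧ ∀ z > q, α ≤ F z := by
  have h1 : quantile F α ≤ (b : EReal) := quantile_le hb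
  have h2 : (a : EReal) ≤ quantile F α := by
    refine le_sInf ?_
    rintro _ ⟨c, hc, rfl⟩
    rw [EReal.coe_le_coe_iff]
    by_contra! h
    exact absurd (hF h.le) (not_le.2 (ha.trans_le hc))
  obtain ⟨q, hq⟩ : ∃ q : ℝ, quantile F α = q := by
    induction h : quantile F α with
    | bot => exact absurd (h ▸ h2) (not_le.2 (EReal.bot_lt_coe _))
    | top => exact absurd (h ▸ h1) (not_le.2 (EReal.coe_lt_top _))
    | coe q => exact ⟨q, rfl⟩
  refine ⟨q, hq, fun z hz => ?_, fun z hz => ?_⟩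
  · by_contra! h
    have := quantile_le h
    rw [hq, EReal.coe_le_coe_iff] at this
    linarith
  · have hlt : quantile F α < (z : EReal) := by rwa [hq, EReal.coe_lt_coe_iff]
    obtain ⟨_, ⟨c, hc, rfl⟩, hcz⟩ := sInf_lt_iff.1 hlt
    exact le_trans hc (hF (EReal.coe_lt_coe_iff.1 hcz).le)

variable {d : ℕ} (T : ProperCone ℝ (Euc d))

theorem monotone_coneCDF : Monotone (coneCDF T) := fun _ _ h =>
  measureReal_mono fun _ hx => le_trans hx h

theorem coneCDF_of_neg {z : ℝ} (hz : z < 0) : coneCDF T z = 0 := by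
  have : {x : Euc d | ‖coneProj T x‖ ^ 2 ≤ z} = ∅ :=
    Set.eq_empty_of_forall_notMem fun x hx => absurd (show _ ≤ z from hx)
      (not_le.2 (hz.trans_le (sq_nonneg _)))
  rw [coneCDF, this, measureReal_empty]

theorem exists_lt_coneCDF {α : ℝ} (hα : α < 1) : ∃ b, α < coneCDF T b := by
  have h := tendsto_measure_compl_closedBall (stdGaussian (Euc d)) (r := fun n : ℕ => (n : ℝ))
    tendsto_natCast_atTop_atTop
  obtain ⟨N, hN⟩ := (h.eventually (gt_mem_nhds (ENNReal.ofReal_pos.2 (sub_pos.2 hα)))).exists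
  refine ⟨(N : ℝ) ^ 2, ?_⟩
  have h1 : (stdGaussian (Euc d)).real (Metric.closedBall 0 (N : ℝ)) ≤ coneCDF T ((N : ℝ) ^ 2) := by
    refine measureReal_mono fun x hx => ?_
    rw [mem_closedBall_zero_iff] at hx
    have := (norm_coneProj_le T x).trans hx
    exact pow_le_pow_left₀ (norm_nonneg _) this 2
  have h2 : (stdGaussian (Euc d)).real (Metric.closedBall 0 (N : ℝ))ᶜ < 1 - α :=
    (ENNReal.lt_ofReal_iff_toReal_lt (measure_ne_top _ _)).1 hN
  rw [probReal_compl_eq_one_sub Metric.isClosed_closedBall.measurableSet] at h2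
  linarith

end Quantile

/-! ### Membership in the two confidence sets. -/

section ConfidenceSets

variable {Θ : Type*} {n : ℕ} {L : Θ → EReal} {θhat θ : Θ} {B : ℕ} {draw : Fin B → Θ} {α m l : ℝ}

theorem mem_confSetQLR (hm : L θhat = m) (hl : L θ = l)
    (h : ((2 * (n * m - n * l) : ℝ) : EReal) < xiMC n L θhat draw α) :
    θ ∈ confSetQLR n L θhat draw α := by
  change qlr n L θhat θ ≤ _
  rw [qlr_eq_coe hm hl]
  exact h.le

theorem qlr_le_of_lt (hm : L θhat = m) {ϑ : Θ} (h : (l : EReal) < L ϑ) (hn : 1 ≤ n) :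
    qlr n L θhat ϑ ≤ ((2 * (n * m - n * l) : ℝ) : EReal) := by
  have hn' : (0 : ℝ) < n := by exact_mod_cast hn
  induction hϑ : L ϑ with
  | bot => exact absurd (hϑ ▸ h) not_lt_bot
  -- A draw with criterion `+∞` has QLR `-∞`.
  | top =>
    rw [qlr, hm, hϑ, sub_eq_add_neg, EReal.neg_top, EReal.add_bot, ← EReal.coe_coe_eq_natCast,
      show (2 : EReal) = ((2 : ℝ) : EReal) from rfl, ← EReal.coe_mul,
      EReal.coe_mul_bot_of_pos (by positivity)]
    exact bot_le
  | coe x =>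
    rw [qlr_eq_coe hm hϑ, EReal.coe_le_coe_iff]
    rw [hϑ, EReal.coe_lt_coe_iff] at h
    have := mul_lt_mul_of_pos_left h hn'
    linarith

/-- A point whose QLR lies strictly below the Monte Carlo quantile belongs to the confidence set
defined through the criterion. -/
theorem mem_confSet (hn : 1 ≤ n) (hB : 1 ≤ B) (hm : L θhat = m) (hl : L θ = l)
    (h : ((2 * (n * m - n * l) : ℝ) : EReal) < xiMC n L θhat draw α) :
    θ ∈ confSet L draw α := by
  classical
  have hB' : (0 : ℝ) < B := by exact_mod_cast hB
  have h1 : empiricalCDF (fun b => qlr n L θhat (draw b)) (2 * (n * m - n * l)) < α := by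
    by_contra! h1
    exact absurd (quantile_le h1) (not_le.2 h)
  change quantile _ _ ≤ L θ
  rw [hl]
  refine quantile_le ?_
  rw [empiricalCDF, Nat.card_eq_fintype_card, Fintype.card_subtype] at h1 ⊢
  rw [div_lt_iff₀ hB'] at h1
  rw [le_div_iff₀ hB']
  -- Fewer than `α B` draws have QLR at most that of `θ`. All the others have criterion at most `l`,
  -- so their share exceeds `1 - α`.
  have h2 := Finset.card_filter_add_card_filter_not (s := (Finset.univ : Finset (Fin B)))
    (fun b => qlr n L θhat (draw b) ≤ ((2 * (n * m - n * l) : ℝ) : EReal))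
  rw [Finset.card_univ, Fintype.card_fin] at h2
  have h3 : (Finset.univ.filter fun b =>
      ¬ qlr n L θhat (draw b) ≤ ((2 * (n * m - n * l) : ℝ) : EReal)).card ≤
      (Finset.univ.filter fun b => L (draw b) ≤ (l : EReal)).card := by
    refine Finset.card_le_card fun b hb => ?_
    rw [Finset.mem_filter] at hb ⊢
    refine ⟨hb.1, ?_⟩
    by_contra! hlt
    exact hb.2 (qlr_le_of_lt hm hlt hn)
  have h2' : ((Finset.univ.filter fun b =>
      qlr n L θhat (draw b) ≤ ((2 * (n * m - n * l) : ℝ) : EReal)).card : ℝ) +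
      (Finset.univ.filter fun b =>
      ¬ qlr n L θhat (draw b) ≤ ((2 * (n * m - n * l) : ℝ) : EReal)).card = B := by
    exact_mod_cast h2
  have h3' : ((Finset.univ.filter fun b =>
      ¬ qlr n L θhat (draw b) ≤ ((2 * (n * m - n * l) : ℝ) : EReal)).card : ℝ) ≤
      (Finset.univ.filter fun b => L (draw b) ≤ (l : EReal)).card := by
    exact_mod_cast h3
  linarith

end ConfidenceSets

theorem ofReal_le_liminf_innerProb {Ω : Type*} [MeasurableSpace Ω] {P : Measure Ω} {α : ℝ}
    (hα : α < 1) {s : ℕ → Set Ω}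
    (h : ∀ β : ℝ, 0 ≤ β → β < α → ∀ᶠ n in atTop, P (s n)ᶜ ≤ ENNReal.ofReal (1 - β)) :
    ENNReal.ofReal α ≤ liminf (fun n => innerProb P (s n)) atTop := by
  refine le_of_forall_lt_imp_le_of_dense fun c hc => ?_
  have hcα : c.toReal < α :=
    (ENNReal.lt_ofReal_iff_toReal_lt (hc.trans ENNReal.ofReal_lt_top).ne).1 hc
  refine le_liminf_of_le (by isBoundedDefault) ?_
  filter_upwards [h c.toReal ENNReal.toReal_nonneg hcα] with n hn
  rw [innerProb]
  calc c = 1 - ENNReal.ofReal (1 - c.toReal) := by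
        rw [ENNReal.ofReal_sub _ ENNReal.toReal_nonneg, ENNReal.ofReal_one,
          ENNReal.ofReal_toReal (hc.trans ENNReal.ofReal_lt_top).ne,
          ENNReal.sub_sub_cancel ENNReal.one_ne_top]
        exact hc.le.trans (ENNReal.ofReal_le_one.2 hα.le)
    _ ≤ _ := tsub_le_tsub_left hn 1

/-! ### Asymptotic coverage of the identified set. -/

section Coverage

variable {Ω Θ : Type*} [MeasurableSpace Ω] [TopologicalSpace Θ] [MeasurableSpace Θ]
  {P : Measure Ω} [IsProbabilityMeasure P] {d k : ℕ} {Ln : ℕ → Ω → Θ → EReal} {prior : Measure Θ}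
  {θhat : ℕ → Ω → Θ} {ΘI ΘN : Set Θ} {Θos : ℕ → Set Θ} {γ : Θ → Euc d} {γp : Θ → Euc k}
  {Γ : Set (Euc d)} {Γp : Set (Euc k)} {T : ProperCone ℝ (Euc d)}
  {ℓ : ℕ → Ω → ℝ} {γhat V : ℕ → Ω → Euc d} {f : ℕ → Ω → Euc k → ℝ}
  {B : ℕ → ℕ} {draw : ∀ n, Ω → Fin (B n) → Θ} {α : ℝ}

/-- Under the information equality the QLR on the identified set is strictly below the Monte Carlo
quantile with asymptotic probability at least `α`. -/
theorem eventually_measure_not_qlr_lt_xiMC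
    (hrep : LocalReparam prior ΘI ΘN Θos γ γp Γ Γp T)
    (hI : ΘI.Nonempty) (hrate : PosteriorContraction P prior Ln θhat Θos)
    (hquad : LocalQuadraticSingular P Ln Θos γ γp Γp T ℓ γhat V f 1)
    (hdom : SupDiffLeOP P (fun n ω => posteriorQLR prior n (Ln n ω) (θhat n ω))
      (fun _ _ => coneCDF T))
    (hα0 : 0 < α) (hα1 : α < 1)
    (hcont : ContinuousAt (coneCDF T) (quantile (coneCDF T) α).toReal)
    (hmc : MCConvergence P prior Ln θhat B draw α) {β : ℝ} (hβ : β < α) :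
    ∀ᶠ n in atTop, P {ω | ¬ ∀ θ ∈ ΘI, ∃ m l : ℝ, Ln n ω (θhat n ω) = m ∧ Ln n ω θ = l ∧
      ((2 * (n * m - n * l) : ℝ) : EReal) < xiMC n (Ln n ω) (θhat n ω) (draw n ω) α} ≤
        ENNReal.ofReal (1 - β) := by
  obtain ⟨b, hb⟩ := exists_lt_coneCDF T hα1
  obtain ⟨q, hq, hqlt, hqgt⟩ := exists_quantile_eq_coe (monotone_coneCDF T)
    (a := -1) (b := b) (by rw [coneCDF_of_neg T (by norm_num)]; exact hα0) hb.le
  rw [hq, EReal.toReal_coe] at hcont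
  have hFq : α ≤ coneCDF T q := by
    refine ge_of_tendsto (hcont.tendsto.mono_left (nhdsWithin_le_nhds (s := Set.Ioi q))) ?_
    filter_upwards [self_mem_nhdsWithin] with z hz using hqgt z hz
  -- Margins: `‖𝐓V‖² < q - 5η` and the expansion error `η` give QLR below `q - 4η`, while the
  -- posterior quantile is at least `q - η` and the Monte Carlo one at least `q - 2η`. The sixth `η`
  -- passes from the closed event to the complement of a sublevel set.
  obtain ⟨η, hη, hFη⟩ : ∃ η > 0, β < coneCDF T (q - 6 * η) := by
    obtain ⟨ρ, hρ, h⟩ := Metric.eventually_nhds_iff.1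
      (hcont.eventually (lt_mem_nhds (hβ.trans_le hFq)))
    refine ⟨ρ / 12, by positivity, h ?_⟩
    rw [Real.dist_eq, abs_lt]
    constructor <;> linarith
  -- The midpoint gives the strict inequality needed for the portmanteau bound `1 - β'`, and leaves
  -- `β' - β` for the other three exceptional events.
  set β' := (β + coneCDF T (q - 6 * η)) / 2 with hβ'
  have hF1 : coneCDF T (q - 6 * η) ≤ 1 := measureReal_le_one
  have hβ'1 : β' < 1 := by linarith
  have hββ' : β < β' := by linarith
  set τ := ENNReal.ofReal (β' - β) with hτ
  have hτ3 : 0 < τ / 3 := ENNReal.div_pos (ENNReal.ofReal_pos.2 (sub_pos.2 hββ')).ne' (by simp)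
  have hlimit := hquad.weak_limit
  have hgauss : multivariateGaussian (0 : Euc d) 1 = stdGaussian (Euc d) :=
    multivariateGaussian_zero_one
  have hFc : IsClosed {x : Euc d | q - 5 * η ≤ ‖coneProj T x‖ ^ 2} :=
    isClosed_le continuous_const ((continuous_coneProj T).norm.pow 2)
  have hFμ : multivariateGaussian (0 : Euc d) 1 {x : Euc d | q - 5 * η ≤ ‖coneProj T x‖ ^ 2} <
      ENNReal.ofReal (1 - β') := by
    rw [hgauss, ENNReal.lt_ofReal_iff_toReal_lt (measure_ne_top _ _)]
    change (stdGaussian (Euc d)).real _ < _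
    have h1 : (stdGaussian (Euc d)).real {x : Euc d | q - 5 * η ≤ ‖coneProj T x‖ ^ 2} ≤
        (stdGaussian (Euc d)).real {x : Euc d | ‖coneProj T x‖ ^ 2 ≤ q - 6 * η}ᶜ := by
      refine measureReal_mono fun x hx hx' => ?_
      linarith [show q - 5 * η ≤ _ from hx, show _ ≤ q - 6 * η from hx']
    rw [probReal_compl_eq_one_sub (measurableSet_norm_coneProj_le T _)] at h1
    change _ ≤ 1 - coneCDF T (q - 6 * η) at h1
    linarith
  -- With a uniform error of half the gap, the posterior distribution function stays below `α` to
  -- the left of `q - η`.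
  have hgap : 0 < (α - coneCDF T (q - η)) / 2 := by linarith [hqlt (q - η) (by linarith)]
  filter_upwards [eventually_measure_lt_of_tendstoInDistribution hlimit hFc hFμ,
    ENNReal.tendsto_nhds_zero.1 (tendsto_measure_not_expansionHolds hrep hI hrate hquad
      (show 0 < η / 8 by positivity)) _ hτ3,
    ENNReal.tendsto_nhds_zero.1 (hdom _ hgap) _ hτ3,
    ENNReal.tendsto_nhds_zero.1 (hmc η hη) _ hτ3] with n hV hexp hpost hmc
  refine (measure_mono (t := {ω | V n ω ∈ {x : Euc d | q - 5 * η ≤ ‖coneProj T x‖ ^ 2}} ∪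
    ({ω | ¬ (Real.sqrt n • γhat n ω = coneProj T (V n ω) ∧ f n ω 0 = 0 ∧
      ExpansionHolds n (Ln n ω) (θhat n ω) (Θos n) (ℓ n ω) (γhat n ω) (f n ω) γ γp (η / 8))} ∪
    ({ω | ¬ ∀ z : ℝ, posteriorQLR prior n (Ln n ω) (θhat n ω) z - coneCDF T z ≤
      (α - coneCDF T (q - η)) / 2} ∪
    {ω | ¬ (xiMC n (Ln n ω) (θhat n ω) (draw n ω) α ≤ xiPost prior n (Ln n ω) (θhat n ω) α +
        ((η * 1 : ℝ) : EReal) ∧ xiPost prior n (Ln n ω) (θhat n ω) α ≤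
        xiMC n (Ln n ω) (θhat n ω) (draw n ω) α + ((η * 1 : ℝ) : EReal))}))) ?_).trans ?_
  · intro ω hω
    by_contra hgood
    simp only [Set.mem_union, Set.mem_ofPred_eq, not_or, not_not, not_le] at hgood
    obtain ⟨h1, ⟨h2, h3, h4⟩, h5, -, h6⟩ := hgood
    refine hω fun θ hθ => ?_
    obtain ⟨hγ0, hγp0⟩ := hrep.eq_zero hθ
    obtain ⟨m, l, hm, hl, hQ⟩ := h4.qlr_le (hrep.subset_os n hθ) hγ0 (by rw [hγp0, h3])
    refine ⟨m, l, hm, hl, ?_⟩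
    have hpost : ((q - η : ℝ) : EReal) ≤ xiPost prior n (Ln n ω) (θhat n ω) α := by
      refine le_sInf ?_
      rintro _ ⟨c, hc, rfl⟩
      rw [EReal.coe_le_coe_iff]
      by_contra! hlt
      have h7 := monotone_coneCDF T hlt.le
      have h8 := h5 c
      have h9 : α ≤ posteriorQLR prior n (Ln n ω) (θhat n ω) c := hc
      linarith
    have hmc' := hpost.trans h6
    have hlt : ((q - 3 * η : ℝ) : EReal) < xiMC n (Ln n ω) (θhat n ω) (draw n ω) α := by
      induction hx : xiMC n (Ln n ω) (θhat n ω) (draw n ω) α with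
      | bot =>
        rw [hx, EReal.bot_add] at hmc'
        exact absurd hmc' (not_le.2 (EReal.bot_lt_coe _))
      | top => exact EReal.coe_lt_top _
      | coe x =>
        rw [hx, ← EReal.coe_add, EReal.coe_le_coe_iff] at hmc'
        rw [EReal.coe_lt_coe_iff]
        linarith
    refine lt_of_le_of_lt (EReal.coe_le_coe_iff.2 ?_) hlt
    rw [h2] at hQ
    linarith
  · refine (measure_union_le _ _).trans ?_
    refine (add_le_add hV.le ((measure_union_le _ _).trans
      (add_le_add hexp ((measure_union_le _ _).trans (add_le_add hpost hmc))))).trans ?_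
    rw [← add_assoc (τ / 3), ENNReal.add_thirds, hτ,
      ← ENNReal.ofReal_add (by linarith) (by linarith)]
    exact ENNReal.ofReal_le_ofReal (by linarith)

end Coverage

theorem theoremt {Ω Θ : Type*} [MeasurableSpace Ω]
    [TopologicalSpace Θ] [MeasurableSpace Θ] [BorelSpace Θ]
    (P : Measure Ω) [IsProbabilityMeasure P]
    -- dimensions of the regular and of the singular part of the local reduced form
    (d k : ℕ) (hd : 1 ≤ d)
    -- population criterion, sample criteria, prior, approximate maximizers
    (L : Θ → EReal) (hI : (identifiedSet L).Nonempty)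
    (Ln : ℕ → Ω → Θ → EReal) (hLn : ∀ n, Measurable (Function.uncurry (Ln n)))
    (prior : Measure Θ) (θhat : ℕ → Ω → Θ)
    -- local reduced-form reparameterization
    (ΘN : Set Θ) (Θos : ℕ → Set Θ) (γ : Θ → Euc d) (γp : Θ → Euc k)
    (Γ : Set (Euc d)) (Γp : Set (Euc k))
    (T : ProperCone ℝ (Euc d)) (hT : 0 < volume (T : Set (Euc d)))
    (hrep : LocalReparam prior (identifiedSet L) ΘN Θos γ γp Γ Γp T)
    -- posterior contraction
    (hrate : PosteriorContraction P prior Ln θhat Θos)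
    -- local quadratic approximation with singularity
    (ℓ : ℕ → Ω → ℝ) (γhat V : ℕ → Ω → Euc d) (f : ℕ → Ω → Euc k → ℝ)
    (S : Matrix (Fin d) (Fin d) ℝ)
    (hquad : LocalQuadraticSingular P Ln Θos γ γp Γp T ℓ γhat V f S)
    -- prior with singularity
    (hprior : PriorSingular P prior Ln ΘN γ γp Γ Γp) :
    -- the posterior of the QLR is asymptotically dominated by the Gaussian on the shifted cone
    SupDiffLeOP P (fun n ω => posteriorQLR prior n (Ln n ω) (θhat n ω))
      (fun n ω => shiftedConeCDF T (Real.sqrt n • γhat n ω)) ∧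
    -- and hence asymptotically stochastically dominates `F_T`
    SupDiffLeOP P (fun n ω => posteriorQLR prior n (Ln n ω) (θhat n ω))
      (fun _ _ => coneCDF T) ∧
    -- coverage of the identified set under the generalized information equality
    (S = 1 → ∀ (B : ℕ → ℕ) (_ : ∀ n, 1 ≤ B n) (draw : ∀ n, Ω → Fin (B n) → Θ)
      (α : ℝ), 0 < α → α < 1 →
      ContinuousAt (coneCDF T) (quantile (coneCDF T) α).toReal →
      MCConvergence P prior Ln θhat B draw α →
      ENNReal.ofReal α ≤ liminf (fun n => innerProb P
        {ω | identifiedSet L ⊆ confSet (Ln n ω) (draw n ω) α}) atTop ∧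
      ENNReal.ofReal α ≤ liminf (fun n => innerProb P
        {ω | identifiedSet L ⊆ confSetQLR n (Ln n ω) (θhat n ω) (draw n ω) α}) atTop) := by
  have h1 := supDiffLeOP_shiftedConeCDF hd hT hrep hI hrate hquad hprior
  have h2 : SupDiffLeOP P (fun n ω => posteriorQLR prior n (Ln n ω) (θhat n ω))
      (fun _ _ => coneCDF T) := h1.mono_right fun n ω z => shiftedConeCDF_le_coneCDF T _ z
  refine ⟨h1, h2, ?_⟩
  rintro rfl B hB draw α hα0 hα1 hcont hmc
  have key : ∀ β < α, _ := fun β hβ =>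
    eventually_measure_not_qlr_lt_xiMC hrep hI hrate hquad h2 hα0 hα1 hcont hmc hβ
  constructor <;> refine ofReal_le_liminf_innerProb hα1 fun β _ hβ => ?_
  · filter_upwards [key β hβ, eventually_ge_atTop 1] with n hn hn1
    refine le_trans (measure_mono ?_) hn
    intro ω hω hgood
    refine hω fun θ hθ => ?_
    obtain ⟨m, l, hm, hl, h⟩ := hgood θ hθ
    exact mem_confSet hn1 (hB n) hm hl h
  · filter_upwards [key β hβ] with n hn
    refine le_trans (measure_mono ?_) hn
    intro ω hω hgood
    refine hω fun θ hθ => ?_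
    obtain ⟨m, l, hm, hl, h⟩ := hgood θ hθ
    exact mem_confSetQLR hm hl h
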